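/- All algebras are vector spaces over $\mathbb C$ with a bilinear product $xy$, and $J(x,y,z)=(xy)z+(yz)x+(zx)y$. An anticommutative algebra is called Lie if $J(x,y,z)=0$ for all $x,y,z$, Malcev if $J(x,y,xz)=J(x,y,z)x$ for all $x,y,z$, and Tortkara if $(ab)(cb)=J(a,b,c)b$ for all $a,b,c$. An algebra is metabelian if $(xy)(zt)=0$ for all $x,y,z,t$, and nilpotent if for some $n\ge 1$ all products of $n$ elements, in every arrangement of brackets, vanish. Consider the following list of anticommutative algebras with basis $e_1,\dots,e_6$ (products $e_ie_j$, $i<j$, that are not written are zero). Lie algebras: $L_{2}$: $e_1e_2=e_3$; $L_{3}$: $e_1e_2=e_3,\ e_1e_3=e_4$; $L_{4}$: $e_1e_2=e_5,\ e_3e_4=e_5$; $L_{5}$: $e_1e_2=e_3,\ e_1e_3=e_5,\ e_2e_4=e_5$; $L_{6}$: $e_1e_2=e_3,\ e_1e_3=e_4,\ e_1e_4=e_5,\ e_2e_3=e_5$; $L_{7}$: $e_1e_2=e_3,\ e_1e_3=e_4,\ e_1e_4=e_5$; $L_{8}$: $e_1e_2=e_4,\ e_1e_3=e_5$; $L_{9}$: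 $e_1e_2=e_3,\ e_1e_3=e_4,\ e_2e_3=e_5$; $L_{10}$: $e_1e_2=e_3,\ e_1e_3=e_6,\ e_4e_5=e_6$; $L_{11}$: $e_1e_2=e_3,\ e_1e_3=e_4,\ e_1e_4=e_6,\ e_2e_3=e_6,\ e_2e_5=e_6$; $L_{12}$: $e_1e_2=e_3,\ e_1e_3=e_4,\ e_1e_4=e_6,\ e_2e_5=e_6$; $L_{13}$: $e_1e_2=e_3,\ e_1e_3=e_5,\ e_2e_4=e_5,\ e_1e_5=e_6,\ e_3e_4=e_6$; $L_{14}$: $e_1e_2=e_3,\ e_1e_3=e_4,\ e_1e_4=e_5,\ e_2e_3=e_5,\ e_2e_5=e_6,\ e_3e_4=-e_6$; $L_{15}$: $e_1e_2=e_3,\ e_1e_3=e_4,\ e_1e_4=e_5,\ e_2e_3=e_5,\ e_1e_5=e_6,\ e_2e_4=e_6$; $L_{16}$: $e_1e_2=e_3,\ e_1e_3=e_4,\ e_1e_4=e_5,\ e_2e_5=e_6,\ e_3e_4=-e_6$; $L_{17}$: $e_1e_2=e_3,\ e_1e_3=e_4,\ e_1e_4=e_5,\ e_1e_5=e_6,\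 e_2e_3=e_6$; $L_{18}$: $e_1e_2=e_3,\ e_1e_3=e_4,\ e_1e_4=e_5,\ e_1e_5=e_6$; $L_{19}^{\varepsilon}$, $\varepsilon\in\{0,1\}$: $e_1e_2=e_4,\ e_1e_3=e_5,\ e_2e_4=e_6,\ e_3e_5=\varepsilon e_6$; $L_{20}$: $e_1e_2=e_4,\ e_1e_3=e_5,\ e_1e_5=e_6,\ e_2e_4=e_6$; $L_{21}^{\varepsilon}$, $\varepsilon\in\{0,1\}$: $e_1e_2=e_3,\ e_1e_3=e_4,\ e_2e_3=e_5,\ e_1e_4=e_6,\ e_2e_5=\varepsilon e_6$; $L_{22}^{\varepsilon}$, $\varepsilon\in\{0,1\}$: $e_1e_2=e_5,\ e_1e_3=e_6,\ e_2e_4=\varepsilon e_6,\ e_3e_4=e_5$; $L_{23}$: $e_1e_2=e_3,\ e_1e_3=e_5,\ e_1e_4=e_6,\ e_2e_4=e_5$; $L_{24}^{\varepsilon}$, $\varepsilon\in\{0,1\}$: $e_1e_2=e_3,\ e_1e_3=e_5,\ e_1e_4=\varepsilon e_6,\ e_2e_3=e_6,\ e_2e_4=e_5$; $L_{25}$: $e_1e_2=e_3,\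 e_1e_3=e_5,\ e_1e_4=e_6$; $L_{26}$: $e_1e_2=e_4,\ e_1e_3=e_5,\ e_2e_3=e_6$. Non-Lie Malcev algebras: $M_{1}$: $e_1e_2=e_3,\ e_3e_4=e_5$; $M_{2}$: $e_1e_2=e_3,\ e_3e_4=e_5,\ e_1e_3=e_6$; $M_{3}$: $e_1e_2=e_3,\ e_3e_4=e_5,\ e_1e_4=e_6$; $M_{4}$: $e_1e_2=e_3,\ e_3e_4=e_5,\ e_1e_3=e_6,\ e_2e_4=e_6$; $M_{5}$: $e_1e_2=e_3,\ e_1e_5=e_6,\ e_3e_4=e_6$; $M_{6}$: $e_1e_2=e_3,\ e_1e_3=e_4,\ e_1e_4=e_6,\ e_3e_5=e_6$; $M_{7}^{\alpha}$, $\alpha\in\mathbb C\setminus\{-1\}$: $e_1e_2=e_4,\ e_1e_3=e_5,\ e_2e_4=e_6,\ e_2e_5=e_6,\ e_3e_4=-e_6,\ e_3e_5=\alpha e_6$; $M_{8}$: $e_1e_2=e_4,\ e_1e_3=e_5,\ e_2e_5=e_6,\ e_3e_4=-e_6$; $M_{9}$: $e_1e_2=e_4,\ e_1e_3=e_5,\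 e_1e_4=e_6,\ e_2e_5=e_6$; $M_{10}$: $e_1e_2=e_5,\ e_3e_4=e_5,\ e_1e_5=e_6$; $M_{11}$: $e_1e_2=e_5,\ e_3e_4=e_5,\ e_1e_5=e_6,\ e_2e_3=e_6$; $M_{12}^{\alpha}$, $\alpha\in\mathbb C\setminus\{-1\}$: $e_1e_2=e_3,\ e_1e_4=e_5,\ e_2e_3=e_5,\ e_2e_5=e_6,\ e_3e_4=\alpha e_6$; $M_{13}$: $e_1e_2=e_3,\ e_1e_4=e_5,\ e_2e_3=e_5,\ e_1e_3=e_6,\ e_2e_5=e_6$. Then: (1) Every algebra of the list is a nilpotent Malcev algebra with nonzero product. (2) Every $6$-dimensional nilpotent Malcev algebra over $\mathbb C$ that is not a Lie algebra is Tortkara, and every $6$-dimensional nilpotent Malcev algebra over $\mathbb C$ that is metabelian (in particular, every metabelian nilpotent Lie algebra of dimension $6$) is Tortkara. (3) Every $6$-dimensional nilpotent algebra over $\mathbb C$ with nonzero product that is both Malcev and Tortkara is isomorphic to an algebra of the list. -/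

import Mathlib

namespace NilpMalcev

/-- A (not necessarily associative) complex algebra structure on a vector space `V`:
a bilinear product. -/
abbrev Alg (V : Type*) [AddCommGroup V] [Module ℂ V] : Type _ := V →ₗ[ℂ] V →ₗ[ℂ] V

section Properties

variable {V : Type*} [AddCommGroup V] [Module ℂ V]

def IsAnticomm (μ : Alg V) : Prop := ∀ x y, μ x y = -μ y x

/-- `J(x,y,z) = (xy)z + (yz)x + (zx)y`. -/
def jac (μ : Alg V) (x y z : V) : V := μ (μ x y) z + μ (μ y z) x + μ (μ z x) y

def IsLie (μ : Alg V) : Prop := IsAnticomm μ ∧ ∀ x y z, jac μ x y z = 0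

/-- Malcev algebra: anticommutative and `J(x,y,xz) = J(x,y,z)x`. -/
def IsMalcev (μ : Alg V) : Prop :=
  IsAnticomm μ ∧ ∀ x y z, jac μ x y (μ x z) = μ (jac μ x y z) x

/-- Tortkara algebra: anticommutative and `(ab)(cb) = J(a,b,c)b`. -/
def IsTortkara (μ : Alg V) : Prop :=
  IsAnticomm μ ∧ ∀ a b c, μ (μ a b) (μ c b) = μ (jac μ a b c) b

/-- Metabelian: `(xy)(zt) = 0`. -/
def IsMetabelian (μ : Alg V) : Prop := ∀ x y z t, μ (μ x y) (μ z t) = 0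

/-- `IsProd μ n a`: `a` is a product of `n` elements with some arrangement of brackets. -/
inductive IsProd (μ : Alg V) : ℕ → V → Prop
  | single (a : V) : IsProd μ 1 a
  | mul {m n : ℕ} {a b : V} : IsProd μ m a → IsProd μ n b → IsProd μ (m + n) (μ a b)

/-- Nilpotent: for some `n ≥ 1` all products of `n` elements, however bracketed, vanish. -/
def IsNilp (μ : Alg V) : Prop := ∃ n, 1 ≤ n ∧ ∀ a, IsProd μ n a → a = 0

end Properties

/-- Isomorphism of algebras. -/
def Iso {V W : Type*} [AddCommGroup V] [Module ℂ V] [AddCommGroup W] [Module ℂ W]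
    (μ : Alg V) (ν : Alg W) : Prop :=
  ∃ f : V ≃ₗ[ℂ] W, ∀ x y, f (μ x y) = ν (f x) (f y)

/-- The product on `ℂ⁶`, with basis `e₁, …, e₆`, given by `eᵢ eⱼ = eₖ = -(eⱼ eᵢ)`, all other
products of basis vectors being zero (for `i ≠ j`). The basis is indexed by `Fin 6`, where the
numeral `6` is the same element as `0`; so `1, …, 6` name the six basis vectors. Sums of such
products give multiplication tables. -/
def prd (i j k : Fin 6) : Alg (Fin 6 → ℂ) :=
  LinearMap.mk₂ ℂ (fun x y => Pi.single k (x i * y j - x j * y i))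
    (fun x x' y => by rw [← Pi.single_add]; congr 1; simp only [Pi.add_apply]; ring)
    (fun c x y => by
      rw [← Pi.single_smul]; congr 1; simp only [Pi.smul_apply, smul_eq_mul]; ring)
    (fun x y y' => by rw [← Pi.single_add]; congr 1; simp only [Pi.add_apply]; ring)
    (fun c x y => by
      rw [← Pi.single_smul]; congr 1; simp only [Pi.smul_apply, smul_eq_mul]; ring)

/-- The list of the nilpotent Malcev algebras of dimension 6 over `ℂ` with nonzero product:
the Lie algebras (`L…`) and the non-Lie Malcev algebras (`M…`, among them two one-parameter
families). -/
inductive IsListed : Alg (Fin 6 → ℂ) → Prop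
  | L2 : IsListed (prd 1 2 3)
  | L3 : IsListed (prd 1 2 3 + prd 1 3 4)
  | L4 : IsListed (prd 1 2 5 + prd 3 4 5)
  | L5 : IsListed (prd 1 2 3 + prd 1 3 5 + prd 2 4 5)
  | L6 : IsListed (prd 1 2 3 + prd 1 3 4 + prd 1 4 5 + prd 2 3 5)
  | L7 : IsListed (prd 1 2 3 + prd 1 3 4 + prd 1 4 5)
  | L8 : IsListed (prd 1 2 4 + prd 1 3 5)
  | L9 : IsListed (prd 1 2 3 + prd 1 3 4 + prd 2 3 5)
  | L10 : IsListed (prd 1 2 3 + prd 1 3 6 + prd 4 5 6)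
  | L11 : IsListed (prd 1 2 3 + prd 1 3 4 + prd 1 4 6 + prd 2 3 6 + prd 2 5 6)
  | L12 : IsListed (prd 1 2 3 + prd 1 3 4 + prd 1 4 6 + prd 2 5 6)
  | L13 : IsListed (prd 1 2 3 + prd 1 3 5 + prd 2 4 5 + prd 1 5 6 + prd 3 4 6)
  | L14 : IsListed (prd 1 2 3 + prd 1 3 4 + prd 1 4 5 + prd 2 3 5 + prd 2 5 6 - prd 3 4 6)
  | L15 : IsListed (prd 1 2 3 + prd 1 3 4 + prd 1 4 5 + prd 2 3 5 + prd 1 5 6 + prd 2 4 6)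
  | L16 : IsListed (prd 1 2 3 + prd 1 3 4 + prd 1 4 5 + prd 2 5 6 - prd 3 4 6)
  | L17 : IsListed (prd 1 2 3 + prd 1 3 4 + prd 1 4 5 + prd 1 5 6 + prd 2 3 6)
  | L18 : IsListed (prd 1 2 3 + prd 1 3 4 + prd 1 4 5 + prd 1 5 6)
  | L19a : IsListed (prd 1 2 4 + prd 1 3 5 + prd 2 4 6)
  | L19b : IsListed (prd 1 2 4 + prd 1 3 5 + prd 2 4 6 + prd 3 5 6)
  | L20 : IsListed (prd 1 2 4 + prd 1 3 5 + prd 1 5 6 + prd 2 4 6)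
  | L21a : IsListed (prd 1 2 3 + prd 1 3 4 + prd 2 3 5 + prd 1 4 6)
  | L21b : IsListed (prd 1 2 3 + prd 1 3 4 + prd 2 3 5 + prd 1 4 6 + prd 2 5 6)
  | L22a : IsListed (prd 1 2 5 + prd 1 3 6 + prd 3 4 5)
  | L22b : IsListed (prd 1 2 5 + prd 1 3 6 + prd 2 4 6 + prd 3 4 5)
  | L23 : IsListed (prd 1 2 3 + prd 1 3 5 + prd 1 4 6 + prd 2 4 5)
  | L24a : IsListed (prd 1 2 3 + prd 1 3 5 + prd 2 3 6 + prd 2 4 5)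
  | L24b : IsListed (prd 1 2 3 + prd 1 3 5 + prd 1 4 6 + prd 2 3 6 + prd 2 4 5)
  | L25 : IsListed (prd 1 2 3 + prd 1 3 5 + prd 1 4 6)
  | L26 : IsListed (prd 1 2 4 + prd 1 3 5 + prd 2 3 6)
  | M1 : IsListed (prd 1 2 3 + prd 3 4 5)
  | M2 : IsListed (prd 1 2 3 + prd 3 4 5 + prd 1 3 6)
  | M3 : IsListed (prd 1 2 3 + prd 3 4 5 + prd 1 4 6)
  | M4 : IsListed (prd 1 2 3 + prd 3 4 5 + prd 1 3 6 + prd 2 4 6)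
  | M5 : IsListed (prd 1 2 3 + prd 1 5 6 + prd 3 4 6)
  | M6 : IsListed (prd 1 2 3 + prd 1 3 4 + prd 1 4 6 + prd 3 5 6)
  | M7 (α : ℂ) (hα : α ≠ -1) :
      IsListed (prd 1 2 4 + prd 1 3 5 + prd 2 4 6 + prd 2 5 6 - prd 3 4 6 + α • prd 3 5 6)
  | M8 : IsListed (prd 1 2 4 + prd 1 3 5 + prd 2 5 6 - prd 3 4 6)
  | M9 : IsListed (prd 1 2 4 + prd 1 3 5 + prd 1 4 6 + prd 2 5 6)
  | M10 : IsListed (prd 1 2 5 + prd 3 4 5 + prd 1 5 6)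
  | M11 : IsListed (prd 1 2 5 + prd 3 4 5 + prd 1 5 6 + prd 2 3 6)
  | M12 (α : ℂ) (hα : α ≠ -1) :
      IsListed (prd 1 2 3 + prd 1 4 5 + prd 2 3 5 + prd 2 5 6 + α • prd 3 4 6)
  | M13 : IsListed (prd 1 2 3 + prd 1 4 5 + prd 2 3 5 + prd 1 3 6 + prd 2 5 6)

end NilpMalcev

/-!
A nilpotent algebra `A ≠ 0` has a nonzero central vector. If the annihilator of `A` is not contained
in `A²`, a central line splits off; otherwise `A` is a one-dimensional central extension of a
nilpotent Malcev algebra of smaller dimension by a skew form. The classification therefore proceeds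
by dimension: for each algebra of one dimension less, the Malcev identity cuts down the coefficients
of the skew form, and explicit base changes bring what is left to a normal form.

Among the algebras of the list, `L₁₄` and `L₁₆` are Lie algebras that are not metabelian. Each of
the others is metabelian and satisfies `J(A, A, A) A = 0 = J(A, A, A²)`, so both sides of the Malcev
identity and of the Tortkara identity vanish. Tortkara algebras therefore need not be singled out
in the classification.
-/

namespace NilpMalcev

section Identities

variable {V : Type*} [AddCommGroup V] [Module ℂ V] {μ : Alg V}

theorem IsLie.isMalcev (h : IsLie μ) : IsMalcev μ :=
  ⟨h.1, fun x y z => by rw [h.2, h.2, map_zero, LinearMap.zero_apply]⟩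

theorem IsAnticomm.isMalcev_of_jac (hA : IsAnticomm μ) (hJ : ∀ x y z w, μ (jac μ x y z) w = 0)
    (hJ' : ∀ x y z w, jac μ x y (μ z w) = 0) : IsMalcev μ :=
  ⟨hA, fun x y z => by rw [hJ, hJ']⟩

theorem IsMetabelian.isTortkara (h : IsMetabelian μ) (hA : IsAnticomm μ)
    (hJ : ∀ x y z w, μ (jac μ x y z) w = 0) : IsTortkara μ :=
  ⟨hA, fun a b c => by rw [h, hJ]⟩

end Identities

section Homomorphisms

variable {V W U : Type*} [AddCommGroup V] [Module ℂ V] [AddCommGroup W] [Module ℂ W]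
  [AddCommGroup U] [Module ℂ U] {μ : Alg V} {ν : Alg W} {ξ : Alg U}

theorem Iso.refl (μ : Alg V) : Iso μ μ :=
  ⟨LinearEquiv.refl ℂ V, fun _ _ => rfl⟩

theorem Iso.symm (h : Iso μ ν) : Iso ν μ := by
  obtain ⟨f, hf⟩ := h
  exact ⟨f.symm, fun x y => by rw [LinearEquiv.symm_apply_eq]; simp [hf]⟩

theorem Iso.trans (h : Iso μ ν) (h' : Iso ν ξ) : Iso μ ξ := by
  obtain ⟨f, hf⟩ := h
  obtain ⟨g, hg⟩ := h'
  exact ⟨f.trans g, fun x y => by simp [hf, hg]⟩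

/-- Surjective homomorphisms of algebras. All identities pass to the target. -/
structure IsSurjHom (μ : Alg V) (ν : Alg W) (f : V →ₗ[ℂ] W) : Prop where
  surjective : Function.Surjective f
  map_mul (x y : V) : f (μ x y) = ν (f x) (f y)

theorem Iso.exists_isSurjHom (h : Iso μ ν) : ∃ f, IsSurjHom μ ν f := by
  obtain ⟨f, hf⟩ := h
  exact ⟨f.toLinearMap, f.surjective, hf⟩

namespace IsSurjHom

variable {f : V →ₗ[ℂ] W}

theorem comp {g : W →ₗ[ℂ] U} (hg : IsSurjHom ν ξ g) (hf : IsSurjHom μ ν f) :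
    IsSurjHom μ ξ (g ∘ₗ f) :=
  ⟨hg.surjective.comp hf.surjective, fun x y => by simp [hf.map_mul, hg.map_mul]⟩

theorem map_jac (hf : IsSurjHom μ ν f) (x y z : V) :
    f (jac μ x y z) = jac ν (f x) (f y) (f z) := by
  simp [jac, hf.map_mul]

theorem isAnticomm (hf : IsSurjHom μ ν f) (h : IsAnticomm μ) : IsAnticomm ν :=
  hf.surjective.forall₂.2 fun x y => by rw [← hf.map_mul, h, map_neg, hf.map_mul]

theorem isLie (hf : IsSurjHom μ ν f) (h : IsLie μ) : IsLie ν :=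
  ⟨hf.isAnticomm h.1, hf.surjective.forall₃.2 fun x y z => by
    rw [← hf.map_jac, h.2, map_zero]⟩

theorem isMalcev (hf : IsSurjHom μ ν f) (h : IsMalcev μ) : IsMalcev ν :=
  ⟨hf.isAnticomm h.1, hf.surjective.forall₃.2 fun x y z => by
    simp only [← hf.map_mul, ← hf.map_jac, h.2]⟩

theorem isTortkara (hf : IsSurjHom μ ν f) (h : IsTortkara μ) : IsTortkara ν :=
  ⟨hf.isAnticomm h.1, hf.surjective.forall₃.2 fun a b c => by
    simp only [← hf.map_mul, ← hf.map_jac, h.2]⟩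

theorem isMetabelian (hf : IsSurjHom μ ν f) (h : IsMetabelian μ) : IsMetabelian ν :=
  hf.surjective.forall₂.2 fun x y => hf.surjective.forall₂.2 fun z t => by
    simp only [← hf.map_mul, h x y z t, map_zero]

theorem exists_isProd (hf : IsSurjHom μ ν f) {n : ℕ} {b : W} (hb : IsProd ν n b) :
    ∃ a, IsProd μ n a ∧ f a = b := by
  induction hb with
  | single b =>
    obtain ⟨a, rfl⟩ := hf.surjective b
    exact ⟨a, .single a, rfl⟩
  | mul _ _ iha ihb =>
    obtain ⟨a, ha, rfl⟩ := iha
    obtain ⟨b, hb, rfl⟩ := ihb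
    exact ⟨μ a b, ha.mul hb, hf.map_mul a b⟩

theorem isNilp (hf : IsSurjHom μ ν f) (h : IsNilp μ) : IsNilp ν := by
  obtain ⟨n, hn, h⟩ := h
  refine ⟨n, hn, fun b hb => ?_⟩
  obtain ⟨a, ha, rfl⟩ := hf.exists_isProd hb
  rw [h a ha, map_zero]

end IsSurjHom

theorem Iso.isMalcev (h : Iso μ ν) (hμ : IsMalcev μ) : IsMalcev ν := by
  obtain ⟨f, hf⟩ := h.exists_isSurjHom
  exact hf.isMalcev hμ

/-- The annihilator of an anticommutative algebra is contained in its square. The square, being the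
span of all products, is encoded by the linear forms vanishing on it. -/
def AnnLeSq (μ : Alg V) : Prop :=
  ∀ z, (∀ x, μ z x = 0) → ∀ φ : Module.Dual ℂ V, (∀ x y, φ (μ x y) = 0) → φ z = 0

theorem Iso.annLeSq (h : Iso μ ν) (hμ : AnnLeSq μ) : AnnLeSq ν := by
  obtain ⟨f, hf⟩ := h
  intro z hz φ hφ
  have hz' : ∀ x, μ (f.symm z) x = 0 := fun x => f.injective (by simp [hf, hz])
  simpa using hμ (f.symm z) hz' (φ ∘ₗ f.toLinearMap) fun x y => by simp [hf, hφ]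

end Homomorphisms

section Nilpotency

variable {V : Type*} [AddCommGroup V] [Module ℂ V] {μ : Alg V}

/-- The witness is a nonzero product of the greatest possible number of factors. -/
theorem IsNilp.exists_central [Nontrivial V] (h : IsNilp μ) : ∃ z ≠ 0, ∀ x, μ z x = 0 := by
  classical
  have h' : ∃ n, ∀ a, IsProd μ (n + 1) a → a = 0 := by
    obtain ⟨n, hn, h⟩ := h
    exact ⟨n - 1, by rwa [Nat.sub_add_cancel hn]⟩
  have hs := Nat.find_spec h'
  rcases hm : Nat.find h' with _ | m
  · rw [hm] at hs
    obtain ⟨a, ha⟩ := exists_ne (0 : V)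
    exact absurd (hs a (.single a)) ha
  · rw [hm] at hs
    have hmin := Nat.find_min h' (m := m) (by lia)
    push Not at hmin
    obtain ⟨a, ha, ha0⟩ := hmin
    exact ⟨a, ha0, fun x => hs _ (ha.mul (.single x))⟩

/-- A product of at least `2 ^ k` factors has a factor that is a product of at least `2 ^ (k - 1)`
factors, so it lies in `F k`. -/
theorem IsAnticomm.isNilp_of_filtration (hA : IsAnticomm μ) {F : ℕ → Submodule ℂ V}
    (hF₀ : F 0 = ⊤) (hF : ∀ k x, ∀ y ∈ F k, μ x y ∈ F (k + 1)) {m : ℕ} (hm : F m = ⊥) :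
    IsNilp μ := by
  have mem_of_isProd : ∀ {n a}, IsProd μ n a → ∀ k, 2 ^ k ≤ n → a ∈ F k := by
    intro n a h
    induction h with
    | single a =>
      intro k hk
      obtain rfl : k = 0 := by_contra fun h => (Nat.one_lt_two_pow h).not_ge hk
      simp [hF₀]
    | @mul p q a b _ _ iha ihb =>
      rintro (_ | k) hk
      · simp [hF₀]
      · rcases le_or_gt (2 ^ k) q with hq | hq
        · exact hF k a b (ihb k hq)
        · rw [hA]
          exact neg_mem (hF k b a (iha k (by rw [pow_succ] at hk; lia)))
  exact ⟨2 ^ m, Nat.one_le_two_pow, fun a ha => by simpa [hm] using mem_of_isProd ha m le_rfl⟩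

end Nilpotency

section SkewForms

theorem exists_ne_zero_forall_apply_eq_zero_of_odd {K V : Type*} [Field K] [NeZero (2 : K)]
    [AddCommGroup V] [Module K V] [FiniteDimensional K V] (hV : Odd (Module.finrank K V))
    {θ : LinearMap.BilinForm K V} (hθ : ∀ x y, θ x y = -θ y x) :
    ∃ v ≠ 0, ∀ x, θ v x = 0 := by
  let b := Module.finBasis K V
  let M := LinearMap.toMatrix₂ b b θ
  have hM : M.transpose = -M := by
    ext i j
    simp only [M, Matrix.transpose_apply, Matrix.neg_apply, LinearMap.toMatrix₂_apply]
    exact hθ _ _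
  have hdet : M.det = 0 := by
    have h : M.det = -M.det := by
      conv_lhs => rw [← M.det_transpose, hM, Matrix.det_neg, Fintype.card_fin, hV.neg_one_pow]
      rw [neg_one_mul]
    rw [eq_neg_iff_add_eq_zero, ← two_mul] at h
    exact (mul_eq_zero.1 h).resolve_left (NeZero.ne 2)
  obtain ⟨c, hc, hMc⟩ := Matrix.exists_mulVec_eq_zero_iff.2 hdet
  refine ⟨b.equivFun.symm c, (map_ne_zero_iff _ b.equivFun.symm.injective).2 hc, fun x => ?_⟩
  rw [hθ, neg_eq_zero, ← b.equivFun.symm_apply_apply x]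
  have := dotProduct_toMatrix₂_mulVec b b θ (b.equivFun x) c
  simpa [M, hMc] using this.symm

theorem exists_skew_matrix {n : ℕ} {θ : LinearMap.BilinForm ℂ (Fin n → ℂ)}
    (hθ : ∀ x y, θ x y = -θ y x) : ∃ t : Fin n → Fin n → ℂ, (∀ i j, t i j = -t j i) ∧
      ∀ x y, θ x y = ∑ i, ∑ j, t i j * (x i * y j) := by
  refine ⟨fun i j => θ (Pi.single i 1) (Pi.single j 1), fun i j => hθ _ _, fun x y => ?_⟩
  conv_lhs => rw [pi_eq_sum_univ' x, pi_eq_sum_univ' y]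
  simp only [map_sum, map_smul, LinearMap.sum_apply, LinearMap.smul_apply, smul_eq_mul,
    Finset.mul_sum]
  rw [Finset.sum_comm]
  exact Finset.sum_congr rfl fun i _ => Finset.sum_congr rfl fun j _ => by ring

end SkewForms

section Tables

variable {n : ℕ}

/-- The analogue on `ℂⁿ` of `prd`, with the same convention that the numeral `n` names the element
`0` of `Fin n`; it is needed for the algebras of dimension less than six. -/
def pr (i j k : Fin n) : Alg (Fin n → ℂ) :=
  LinearMap.mk₂ ℂ (fun x y => Pi.single k (x i * y j - x j * y i))
    (fun x x' y => by rw [← Pi.single_add]; congr 1; simp only [Pi.add_apply]; ring)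
    (fun c x y => by
      rw [← Pi.single_smul]; congr 1; simp only [Pi.smul_apply, smul_eq_mul]; ring)
    (fun x y y' => by rw [← Pi.single_add]; congr 1; simp only [Pi.add_apply]; ring)
    (fun c x y => by
      rw [← Pi.single_smul]; congr 1; simp only [Pi.smul_apply, smul_eq_mul]; ring)

theorem pr_apply (i j k l : Fin n) (x y : Fin n → ℂ) :
    pr i j k x y l = if l = k then x i * y j - x j * y i else 0 := by
  simp [pr, Pi.single_apply]

theorem prd_apply (i j k l : Fin 6) (x y : Fin 6 → ℂ) :
    prd i j k x y l = if l = k then x i * y j - x j * y i else 0 := pr_apply i j k l x y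

theorem isAnticomm_pr (i j k : Fin n) : IsAnticomm (pr i j k) := fun x y => by
  ext l
  rw [Pi.neg_apply, pr_apply, pr_apply]
  split_ifs <;> ring

variable [NeZero n]

/-- The multiplication tables on `ℂⁿ` in which the product of two basis vectors is a combination of
later ones. The shift by one puts the index `0`, which stands for `n`, in the last place. -/
def triangularTables (n : ℕ) [NeZero n] : Submodule ℂ (Alg (Fin n → ℂ)) :=
  Submodule.span ℂ {μ | ∃ i j k : Fin n, i - 1 < k - 1 ∧ j - 1 < k - 1 ∧ μ = pr i j k}

theorem pr_mem_triangularTables {i j k : Fin n} (hi : i - 1 < k - 1) (hj : j - 1 < k - 1) :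
    pr i j k ∈ triangularTables n :=
  Submodule.subset_span ⟨i, j, k, hi, hj, rfl⟩

theorem isAnticomm_of_mem_triangularTables {μ : Alg (Fin n → ℂ)} (h : μ ∈ triangularTables n) :
    IsAnticomm μ := by
  induction h using Submodule.span_induction with
  | mem _ h =>
    obtain ⟨i, j, k, -, -, rfl⟩ := h
    exact isAnticomm_pr i j k
  | zero => exact fun x y => by simp
  | add μ ν _ _ hμ hν => exact fun x y => by simp [hμ x y, hν x y, add_comm]
  | smul c μ _ hμ => exact fun x y => by simp [hμ x y]

/-- The `k`-th step of the standard descending flag of `ℂⁿ`, spanned by the basis vectors from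
`eₖ₊₁` on; as in `triangularTables`, the index `0` comes last. -/
def coordFlag (n k : ℕ) [NeZero n] : Submodule ℂ (Fin n → ℂ) :=
  Submodule.pi {i | (i - 1).val < k} fun _ => ⊥

theorem mem_coordFlag {k : ℕ} {x : Fin n → ℂ} :
    x ∈ coordFlag n k ↔ ∀ i : Fin n, (i - 1).val < k → x i = 0 := by
  simp [coordFlag, Submodule.mem_pi]

theorem mul_mem_coordFlag {μ : Alg (Fin n → ℂ)} (h : μ ∈ triangularTables n) {k : ℕ}
    (x : Fin n → ℂ) {y : Fin n → ℂ} (hy : y ∈ coordFlag n k) : μ x y ∈ coordFlag n (k + 1) := by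
  induction h using Submodule.span_induction with
  | mem _ h =>
    obtain ⟨i, j, l, hi, hj, rfl⟩ := h
    rw [mem_coordFlag] at hy ⊢
    intro m hm
    rw [pr_apply]
    split_ifs with hml
    · subst hml
      rw [hy i (by lia), hy j (by lia), mul_zero, mul_zero, sub_zero]
    · rfl
  | zero => exact zero_mem _
  | add μ ν _ _ hμ hν => exact add_mem hμ hν
  | smul c μ _ hμ => exact Submodule.smul_mem _ c hμ

theorem isNilp_of_mem_triangularTables {μ : Alg (Fin n → ℂ)} (h : μ ∈ triangularTables n) :
    IsNilp μ := by
  refine (isAnticomm_of_mem_triangularTables h).isNilp_of_filtration (F := (coordFlag n ·)) (m := n)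
    ?_ (fun k x y hy => mul_mem_coordFlag h x hy) ?_
  · ext x
    simp [mem_coordFlag]
  · ext x
    simp [mem_coordFlag, funext_iff]

end Tables

section Extensions

variable {n : ℕ} [NeZero n]

/-- The inclusion of the index set of an `n`-dimensional algebra into that of its one-dimensional
extension; the numerals `1, …, n` are preserved, where `n` is the same element as `0` of `Fin n`. -/
def up (i : Fin n) : Fin (n + 1) := (i - 1).succ

theorem cons_comp_up (a : ℂ) (x : Fin n → ℂ) :
    (Fin.cons a fun k => x (k + 1) : Fin (n + 1) → ℂ) ∘ up = x := by
  ext i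
  simp [up]

/-- The central extension of `B` by the bilinear form `θ`. The new basis vector has the index
`0`. -/
def extend (B : Alg (Fin n → ℂ)) (θ : LinearMap.BilinForm ℂ (Fin n → ℂ)) :
    Alg (Fin (n + 1) → ℂ) :=
  LinearMap.mk₂ ℂ
    (fun x y => Fin.cons (θ (x ∘ up) (y ∘ up)) fun k => B (x ∘ up) (y ∘ up) (k + 1))
    (fun x x' y => by ext j; cases j using Fin.cases <;> simp [Pi.add_comp])
    (fun c x y => by ext j; cases j using Fin.cases <;> simp [Pi.smul_comp])
    (fun x y y' => by ext j; cases j using Fin.cases <;> simp [Pi.add_comp])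
    (fun c x y => by ext j; cases j using Fin.cases <;> simp [Pi.smul_comp])

theorem extend_apply (B : Alg (Fin n → ℂ)) (θ : LinearMap.BilinForm ℂ (Fin n → ℂ))
    (x y : Fin (n + 1) → ℂ) : extend B θ x y =
      Fin.cons (θ (x ∘ up) (y ∘ up)) fun k => B (x ∘ up) (y ∘ up) (k + 1) := rfl

theorem extend_zero : extend (0 : Alg (Fin n → ℂ)) 0 = 0 := by
  refine LinearMap.ext₂ fun x y => funext fun j => ?_
  cases j using Fin.cases <;> simp [extend_apply]

theorem extend_add (B B' : Alg (Fin n → ℂ)) : extend (B + B') 0 = extend B 0 + extend B' 0 := by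
  refine LinearMap.ext₂ fun x y => funext fun j => ?_
  cases j using Fin.cases <;> simp [extend_apply]

theorem extend_pr (i j k : Fin n) : extend (pr i j k) 0 = pr (up i) (up j) (up k) := by
  refine LinearMap.ext₂ fun x y => funext fun l => ?_
  cases l using Fin.cases with
  | zero => simp [extend_apply, pr_apply, up, (Fin.succ_ne_zero _).symm]
  | succ l => simp [extend_apply, pr_apply, up, eq_sub_iff_add_eq]

theorem not_annLeSq_extend_of_odd (hn : Odd n) {θ : LinearMap.BilinForm ℂ (Fin n → ℂ)}
    (hθ : ∀ x y, θ x y = -θ y x) : ¬ AnnLeSq (extend (0 : Alg (Fin n → ℂ)) θ) := by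
  intro h
  obtain ⟨v, hv₀, hv⟩ := exists_ne_zero_forall_apply_eq_zero_of_odd (by simpa using hn) hθ
  refine hv₀ (funext fun i => ?_)
  have hcentral : ∀ x, extend 0 θ (Fin.cons 0 fun k => v (k + 1)) x = 0 := fun x => by
    ext j
    cases j using Fin.cases <;> simp [extend_apply, cons_comp_up, hv]
  have := h _ hcentral (LinearMap.proj (up i)) fun x y => by simp [extend_apply, up]
  simpa [up] using this

/-- Splitting off a central line: the quotient by `z` is modelled on the complement `ker φ`. -/
theorem IsAnticomm.exists_quotient {V : Type*} [AddCommGroup V] [Module ℂ V] {μ : Alg V}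
    (hA : IsAnticomm μ) {z : V} (hz : ∀ x, μ z x = 0) {φ : Module.Dual ℂ V} (hφ : φ z = 1) :
    ∃ (B : Alg (LinearMap.ker φ)) (π : V →ₗ[ℂ] LinearMap.ker φ), IsSurjHom μ B π ∧
      (∀ v, φ v = 0 → π v = 0 → v = 0) ∧ ∀ x y, μ (π x) (π y) = μ x y := by
  have hz' : ∀ x, μ x z = 0 := fun x => by rw [hA, hz, neg_zero]
  let π : V →ₗ[ℂ] LinearMap.ker φ :=
    (LinearMap.id - φ.smulRight z).codRestrict _ (fun v => by simp [hφ])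
  have hπ : ∀ v, (π v : V) = v - φ v • z := fun v => rfl
  have hμ : ∀ x y, μ (π x) (π y) = μ x y := fun x y => by simp [hπ, hz, hz']
  have hπ' : ∀ v : LinearMap.ker φ, π v = v := fun v => Subtype.ext (by simp [hπ])
  refine ⟨(μ.compl₁₂ (LinearMap.ker φ).subtype (LinearMap.ker φ).subtype).compr₂ π, π,
    ⟨fun v => ⟨v, hπ' v⟩, fun x y => by simp [hμ]⟩, fun v h₀ hv => ?_, hμ⟩
  simpa [hπ, h₀] using congrArg Subtype.val hv

theorem IsSurjHom.iso_extend {V : Type*} [AddCommGroup V] [Module ℂ V] {μ : Alg V}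
    (hV : Module.finrank ℂ V = n + 1) {B : Alg (Fin n → ℂ)} {π : V →ₗ[ℂ] Fin n → ℂ}
    (hπ : IsSurjHom μ B π) {φ : Module.Dual ℂ V} (hinj : ∀ v, φ v = 0 → π v = 0 → v = 0)
    {θ : LinearMap.BilinForm ℂ (Fin n → ℂ)} (hθ : ∀ x y, φ (μ x y) = θ (π x) (π y)) :
    Iso μ (extend B θ) := by
  have : FiniteDimensional ℂ V := Module.finite_of_finrank_eq_succ hV
  let g : V →ₗ[ℂ] (Fin (n + 1) → ℂ) :=
    { toFun := fun v => Fin.cons (φ v) fun k => π v (k + 1)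
      map_add' := fun v w => by ext j; cases j using Fin.cases <;> simp
      map_smul' := fun c v => by ext j; cases j using Fin.cases <;> simp }
  have hg : ∀ v, g v = Fin.cons (φ v) fun k => π v (k + 1) := fun _ => rfl
  have hgup : ∀ v, g v ∘ up = π v := fun v => cons_comp_up _ _
  have hginj : Function.Injective g := by
    rw [← LinearMap.ker_eq_bot, LinearMap.ker_eq_bot']
    refine fun v hv => hinj v (congrFun hv 0) ?_
    rw [← hgup, hv]
    rfl
  refine ⟨LinearEquiv.ofInjectiveOfFinrankEq g hginj (by simp [hV]), fun x y => ?_⟩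
  change g (μ x y) = extend B θ (g x) (g y)
  rw [extend_apply, hgup, hgup, hg, hθ, hπ.map_mul]

/-- A list `D` of `n`-dimensional algebras represents all `n`-dimensional nilpotent Malcev algebras
up to isomorphism. -/
def IsComplete.{u} (n : ℕ) (D : Alg (Fin n → ℂ) → Prop) : Prop :=
  ∀ (V : Type u) [AddCommGroup V] [Module ℂ V] (μ : Alg V), Module.finrank ℂ V = n →
    IsNilp μ → IsMalcev μ → ∃ ν, D ν ∧ Iso μ ν

theorem isComplete_one : IsComplete.{u} 1 (· = 0) := by
  intro V _ _ μ hV _ hM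
  have : FiniteDimensional ℂ V := Module.finite_of_finrank_eq_succ hV
  refine ⟨0, rfl, LinearEquiv.ofFinrankEq _ _ (by simp [hV]), fun x y => ?_⟩
  obtain ⟨v, -, hv⟩ := finrank_eq_one_iff'.1 hV
  obtain ⟨a, rfl⟩ := hv x
  obtain ⟨b, rfl⟩ := hv y
  have : IsAddTorsionFree V := .of_isTorsionFree ℂ V
  have : μ v v = 0 := self_eq_neg.1 (hM.1 v v)
  simp [this]

theorem IsComplete.exists_extension {C : Alg (Fin n → ℂ) → Prop} (hC : IsComplete.{u} n C)
    {V : Type u} [AddCommGroup V] [Module ℂ V] {μ : Alg V} (hV : Module.finrank ℂ V = n + 1)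
    (hN : IsNilp μ) (hM : IsMalcev μ) {z : V} (hz : ∀ x, μ z x = 0) {φ : Module.Dual ℂ V}
    (hφ : φ z = 1) : ∃ B, C B ∧ ∃ θ : LinearMap.BilinForm ℂ (Fin n → ℂ),
      (∀ x y, θ x y = -θ y x) ∧ ((∀ x y, φ (μ x y) = 0) → θ = 0) ∧ Iso μ (extend B θ) := by
  obtain ⟨B, π, hπ, hinj, hμπ⟩ := hM.1.exists_quotient hz hφ
  have hker : Module.finrank ℂ (LinearMap.ker φ) = n := by
    have : FiniteDimensional ℂ V := Module.finite_of_finrank_eq_succ hV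
    have h := φ.finrank_range_add_finrank_ker
    rw [LinearMap.range_eq_top.2 fun c => ⟨c • z, by simp [hφ]⟩, finrank_top,
      Module.finrank_self] at h
    lia
  obtain ⟨B', hB', f, hf⟩ := hC _ B hker (hπ.isNilp hN) (hπ.isMalcev hM)
  let s : (Fin n → ℂ) →ₗ[ℂ] V := (LinearMap.ker φ).subtype ∘ₗ f.symm.toLinearMap
  refine ⟨B', hB', (μ.compl₁₂ s s).compr₂ φ, fun x y => ?_, fun h => by ext; simp [h], ?_⟩
  · simp only [LinearMap.compr₂_apply, LinearMap.compl₁₂_apply]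
    rw [hM.1, map_neg]
  · have hfπ : IsSurjHom μ B' (f.toLinearMap ∘ₗ π) := .comp ⟨f.surjective, hf⟩ hπ
    exact hfπ.iso_extend hV (fun v h₀ hv => hinj v h₀ (by simpa using hv))
      fun x y => by simp [s, hμπ]

/-- The list `D` contains an algebra isomorphic to `μ`, provided `μ` is a Malcev algebra with
annihilator in its square. The proviso is part of the notion because normal forms are reached by
chains of isomorphisms, along which it is passed on. -/
def Classified (D : Alg (Fin n → ℂ) → Prop) (μ : Alg (Fin n → ℂ)) : Prop :=
  IsMalcev μ → AnnLeSq μ → ∃ ν, D ν ∧ Iso μ ν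

theorem IsComplete.succ {C : Alg (Fin n → ℂ) → Prop} {D : Alg (Fin (n + 1) → ℂ) → Prop}
    (hC : IsComplete.{u} n C) (hzero : ∀ B, C B → D (extend B 0))
    (hext : ∀ B, C B → ∀ θ : LinearMap.BilinForm ℂ (Fin n → ℂ), (∀ x y, θ x y = -θ y x) →
      Classified D (extend B θ)) : IsComplete.{u} (n + 1) D := by
  intro V _ _ μ hV hN hM
  by_cases hZ : AnnLeSq μ
  · have : Nontrivial V := Module.nontrivial_of_finrank_eq_succ hV
    obtain ⟨z, hz0, hz⟩ := hN.exists_central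
    obtain ⟨φ, hφ⟩ := Module.Projective.exists_dual_eq_one ℂ hz0
    obtain ⟨B, hB, θ, hθ, -, e⟩ := hC.exists_extension hV hN hM hz hφ
    obtain ⟨ν, hν, e'⟩ := hext B hB θ hθ (e.isMalcev hM) (e.annLeSq hZ)
    exact ⟨ν, hν, e.trans e'⟩
  · unfold AnnLeSq at hZ
    push Not at hZ
    obtain ⟨z, hz, φ, hφ, hφz⟩ := hZ
    obtain ⟨B, hB, θ, -, hθ, e⟩ := hC.exists_extension hV hN hM hz (φ := (φ z)⁻¹ • φ)
      (by simp [hφz])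
    rw [hθ fun x y => by simp [hφ]] at e
    exact ⟨_, hzero B hB, e⟩

end Extensions

section BaseChange

variable {n : ℕ} {μ ν : Alg (Fin n → ℂ)}

/-- Row `j` of `v` consists of the `μ`-coordinates of the vector that replaces the `j`-th basis
vector of `ν`. Row and column `0` belong to the basis vector with the last numeral, since `Fin n`
reads `n` as `0`. The default arguments verify an explicit base change. -/
theorem Iso.of_basis (v : Fin n → Fin n → ℂ)
    (hv : ∀ x : Fin n → ℂ, (∀ i, ∑ j, x j * v j i = 0) → ∀ i, x i = 0 := by
      intro x hx
      simp [Fin.forall_fin_succ, Fin.sum_univ_succ] at hx ⊢ <;> grind)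
    (h : ∀ x y i, ∑ j, ν x y j * v j i =
      μ (fun i => ∑ j, x j * v j i) (fun i => ∑ j, y j * v j i) i := by
      intro x y
      simp [Fin.forall_fin_succ, Fin.sum_univ_succ, pr_apply, prd_apply]
      try constructorm* _ ∧ _
      all_goals first | ring1 | (field_simp; ring1) | grind) : Iso μ ν := by
  have hcomb : ∀ x i, Fintype.linearCombination ℂ v x i = ∑ j, x j * v j i := fun x i => by
    simp [Fintype.linearCombination_apply]
  refine Iso.symm ⟨LinearEquiv.ofInjectiveEndo (Fintype.linearCombination ℂ v) ?_,
    fun x y => funext fun i => ?_⟩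
  · rw [← LinearMap.ker_eq_bot, LinearMap.ker_eq_bot']
    exact fun x hx => funext (hv x fun i => by rw [← hcomb, hx]; rfl)
  · have := h x y i
    simp only [← hcomb] at this
    exact this

theorem AnnLeSq.coord_eq_zero (h : AnnLeSq μ) (z : Fin n → ℂ) (i : Fin n)
    (hz : ∀ x j, μ z x j = 0 := by
      intro x
      simp [Fin.forall_fin_succ, pr_apply, prd_apply] <;> grind)
    (hi : ∀ x y, μ x y i = 0 := by
      intro x y
      simp [pr_apply, prd_apply]) : z i = 0 :=
  h z (fun x => funext (hz x)) (LinearMap.proj i) hi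

theorem AnnLeSq.dotProduct_eq_zero (h : AnnLeSq μ) (z c : Fin n → ℂ)
    (hz : ∀ x j, μ z x j = 0 := by
      intro x
      simp [Fin.forall_fin_succ, pr_apply, prd_apply] <;> grind)
    (hc : ∀ x y, ∑ i, c i * μ x y i = 0 := by
      intro x y
      simp [Fin.sum_univ_succ, pr_apply, prd_apply] <;> grind) : ∑ i, c i * z i = 0 := by
  have := h z (fun x => funext (hz x)) (∑ i, c i • LinearMap.proj i) (by simpa using hc)
  simpa using this

end BaseChange

section LowDimension

theorem exists_extend_eq_three (B : Alg (Fin 2 → ℂ)) {θ : LinearMap.BilinForm ℂ (Fin 2 → ℂ)}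
    (hθ : ∀ x y, θ x y = -θ y x) : ∃ a : ℂ, extend B θ = extend B 0 + a • pr 1 2 3 := by
  obtain ⟨t, ht, h⟩ := exists_skew_matrix hθ
  refine ⟨t 1 0, LinearMap.ext₂ fun x y => funext fun j => ?_⟩
  simp only [Fin.forall_fin_succ] at ht
  revert j
  simp [Fin.forall_fin_succ, Fin.sum_univ_succ, extend_apply, pr_apply, h, up] at ht ⊢
  grind

theorem exists_extend_eq_four (B : Alg (Fin 3 → ℂ)) {θ : LinearMap.BilinForm ℂ (Fin 3 → ℂ)}
    (hθ : ∀ x y, θ x y = -θ y x) : ∃ a₁₂ a₁₃ a₂₃ : ℂ, extend B θ =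
      extend B 0 + (a₁₂ • pr 1 2 4 + a₁₃ • pr 1 3 4 + a₂₃ • pr 2 3 4) := by
  obtain ⟨t, ht, h⟩ := exists_skew_matrix hθ
  refine ⟨t 1 2, t 1 0, t 2 0, LinearMap.ext₂ fun x y => funext fun j => ?_⟩
  simp only [Fin.forall_fin_succ] at ht
  revert j
  simp [Fin.forall_fin_succ, Fin.sum_univ_succ, extend_apply, pr_apply, h, up] at ht ⊢
  grind

/-- The products of a five-dimensional algebra with values in the line of `e₅`. -/
def cen5 (a₁₂ a₁₃ a₁₄ a₂₃ a₂₄ a₃₄ : ℂ) : Alg (Fin 5 → ℂ) :=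
  a₁₂ • pr 1 2 5 + a₁₃ • pr 1 3 5 + a₁₄ • pr 1 4 5 + a₂₃ • pr 2 3 5 + a₂₄ • pr 2 4 5 +
    a₃₄ • pr 3 4 5

@[simp]
theorem cen5_apply (a₁₂ a₁₃ a₁₄ a₂₃ a₂₄ a₃₄ : ℂ) (x y : Fin 5 → ℂ) (l : Fin 5) :
    cen5 a₁₂ a₁₃ a₁₄ a₂₃ a₂₄ a₃₄ x y l = if l = 0 then
      a₁₂ * (x 1 * y 2 - x 2 * y 1) + a₁₃ * (x 1 * y 3 - x 3 * y 1) +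
      a₁₄ * (x 1 * y 4 - x 4 * y 1) + a₂₃ * (x 2 * y 3 - x 3 * y 2) +
      a₂₄ * (x 2 * y 4 - x 4 * y 2) + a₃₄ * (x 3 * y 4 - x 4 * y 3) else 0 := by
  simp only [cen5, LinearMap.add_apply, LinearMap.smul_apply, Pi.add_apply, Pi.smul_apply,
    pr_apply, smul_eq_mul, show (5 : Fin 5) = 0 from rfl]
  split_ifs <;> ring

theorem exists_extend_eq_five (B : Alg (Fin 4 → ℂ)) {θ : LinearMap.BilinForm ℂ (Fin 4 → ℂ)}
    (hθ : ∀ x y, θ x y = -θ y x) : ∃ a₁₂ a₁₃ a₁₄ a₂₃ a₂₄ a₃₄ : ℂ, extend B θ =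
      extend B 0 + cen5 a₁₂ a₁₃ a₁₄ a₂₃ a₂₄ a₃₄ := by
  obtain ⟨t, ht, h⟩ := exists_skew_matrix hθ
  refine ⟨t 1 2, t 1 3, t 1 0, t 2 3, t 2 0, t 3 0, LinearMap.ext₂ fun x y => funext fun j => ?_⟩
  simp only [Fin.forall_fin_succ] at ht
  revert j
  simp [Fin.forall_fin_succ, Fin.sum_univ_succ, extend_apply, h, up] at ht ⊢
  grind

/-- Representatives of the nilpotent Malcev algebras of dimension three. -/
inductive Listed3 : Alg (Fin 3 → ℂ) → Prop
  | zero : Listed3 0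
  | L2 : Listed3 (pr 1 2 3)

/-- Representatives of the nilpotent Malcev algebras of dimension four. -/
inductive Listed4 : Alg (Fin 4 → ℂ) → Prop
  | zero : Listed4 0
  | L2 : Listed4 (pr 1 2 3)
  | L3 : Listed4 (pr 1 2 3 + pr 1 3 4)

/-- Representatives of the nilpotent Malcev algebras of dimension five, named after the algebras
of `IsListed` that they give by adding a central line. -/
inductive Listed5 : Alg (Fin 5 → ℂ) → Prop
  | zero : Listed5 0
  | L2 : Listed5 (pr 1 2 3)
  | L3 : Listed5 (pr 1 2 3 + pr 1 3 4)
  | L4 : Listed5 (pr 1 2 5 + pr 3 4 5)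
  | L5 : Listed5 (pr 1 2 3 + pr 1 3 5 + pr 2 4 5)
  | L6 : Listed5 (pr 1 2 3 + pr 1 3 4 + pr 1 4 5 + pr 2 3 5)
  | L7 : Listed5 (pr 1 2 3 + pr 1 3 4 + pr 1 4 5)
  | L8 : Listed5 (pr 1 2 4 + pr 1 3 5)
  | L9 : Listed5 (pr 1 2 3 + pr 1 3 4 + pr 2 3 5)
  | M1 : Listed5 (pr 1 2 3 + pr 3 4 5)

theorem isComplete_two : IsComplete.{u} 2 (· = 0) := by
  refine isComplete_one.succ ?_ ?_
  · rintro _ rfl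
    exact extend_zero
  · rintro _ rfl θ hθ - hZ
    exact absurd hZ (not_annLeSq_extend_of_odd odd_one hθ)

theorem isComplete_three : IsComplete.{u} 3 Listed3 := by
  refine isComplete_two.succ ?_ ?_
  · rintro _ rfl
    rw [extend_zero]
    exact .zero
  · rintro _ rfl θ hθ - -
    obtain ⟨a, h⟩ := exists_extend_eq_three 0 hθ
    rw [h, extend_zero, zero_add]
    rcases eq_or_ne a 0 with rfl | ha
    · exact ⟨0, .zero, by rw [zero_smul]; exact .refl 0⟩
    · exact ⟨_, .L2, .of_basis ![![a, 0, 0], ![0, 1, 0], ![0, 0, 1]]⟩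

theorem classified_L2_four (a₁₂ a₁₃ a₂₃ : ℂ) : Classified Listed4
    (pr 1 2 3 + (a₁₂ • pr 1 2 4 + a₁₃ • pr 1 3 4 + a₂₃ • pr 2 3 4)) := by
  refine fun _ hZ => ⟨_, .L3, ?_⟩
  rcases ne_or_eq a₁₃ 0 with h | rfl
  · exact .of_basis ![![a₁₃, 0, 0, 0], ![0, 1, 0, 0], ![0, -a₂₃ / a₁₃, 1, 0], ![a₁₂, 0, 0, 1]]
  rcases ne_or_eq a₂₃ 0 with h | rfl
  · exact .of_basis ![![-a₂₃, 0, 0, 0], ![0, 0, 1, 0], ![0, 1, 0, 0], ![-a₁₂, 0, 0, -1]]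
  simpa [Fin.sum_univ_succ] using hZ.dotProduct_eq_zero ![1, 0, 0, 0] ![1, 0, 0, -a₁₂]

theorem isComplete_four : IsComplete.{u} 4 Listed4 := by
  have h₂ : extend (pr (1 : Fin 3) 2 3) 0 = pr 1 2 3 := extend_pr _ _ _
  refine isComplete_three.succ ?_ ?_
  · rintro _ (_ | _)
    · rw [extend_zero]
      exact .zero
    · rw [h₂]
      exact .L2
  · rintro _ (_ | _) θ hθ
    · exact fun _ hZ => absurd hZ (not_annLeSq_extend_of_odd (by decide) hθ)
    · obtain ⟨a₁₂, a₁₃, a₂₃, h⟩ := exists_extend_eq_four (pr 1 2 3) hθ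
      rw [h, h₂]
      exact classified_L2_four a₁₂ a₁₃ a₂₃

theorem iso_L4_of_ne_zero {a₁₂ a₁₃ a₁₄ a₂₃ a₂₄ a₃₄ : ℂ} (h : a₁₂ ≠ 0)
    (hZ : AnnLeSq (cen5 a₁₂ a₁₃ a₁₄ a₂₃ a₂₄ a₃₄)) :
    Iso (cen5 a₁₂ a₁₃ a₁₄ a₂₃ a₂₄ a₃₄) (pr (1 : Fin 5) 2 5 + pr 3 4 5) := by
  -- the Pfaffian of the skew form
  obtain ⟨d, hd⟩ : ∃ d, d = a₁₂ * a₃₄ - a₁₃ * a₂₄ + a₁₄ * a₂₃ := ⟨_, rfl⟩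
  rcases ne_or_eq d 0 with hd₀ | rfl
  · exact .of_basis ![![a₁₂ * d, 0, 0, 0, 0], ![0, 1, 0, 0, 0], ![0, 0, d, 0, 0],
      ![0, a₂₃, -a₁₃, a₁₂, 0], ![0, a₂₄, -a₁₄, 0, a₁₂]]
  · simpa [h] using hZ.coord_eq_zero ![0, a₂₃, -a₁₃, a₁₂, 0] 3

theorem classified_cen5 (a₁₂ a₁₃ a₁₄ a₂₃ a₂₄ a₃₄ : ℂ) :
    Classified Listed5 (cen5 a₁₂ a₁₃ a₁₄ a₂₃ a₂₄ a₃₄) := by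
  refine fun _ hZ => ⟨_, .L4, ?_⟩
  have of_iso {b₁₂ b₁₃ b₁₄ b₂₃ b₂₄ b₃₄ : ℂ} (h : b₁₂ ≠ 0)
      (e : Iso (cen5 a₁₂ a₁₃ a₁₄ a₂₃ a₂₄ a₃₄) (cen5 b₁₂ b₁₃ b₁₄ b₂₃ b₂₄ b₃₄)) :
      Iso (cen5 a₁₂ a₁₃ a₁₄ a₂₃ a₂₄ a₃₄) (pr (1 : Fin 5) 2 5 + pr 3 4 5) :=
    e.trans (iso_L4_of_ne_zero h (e.annLeSq hZ))
  rcases ne_or_eq a₁₂ 0 with h | rfl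
  · exact iso_L4_of_ne_zero h hZ
  rcases ne_or_eq a₃₄ 0 with h | rfl
  · exact of_iso (b₁₃ := -a₁₃) (b₁₄ := -a₂₃) (b₂₃ := -a₁₄) (b₂₄ := -a₂₄) (b₃₄ := 0) h
      (.of_basis ![![1, 0, 0, 0, 0], ![0, 0, 0, 1, 0], ![0, 0, 0, 0, 1], ![0, 1, 0, 0, 0],
        ![0, 0, 1, 0, 0]])
  rcases ne_or_eq a₁₃ 0 with h | rfl
  · exact of_iso (b₁₃ := 0) (b₁₄ := a₁₄) (b₂₃ := -a₂₃) (b₂₄ := 0) (b₃₄ := a₂₄) h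
      (.of_basis ![![1, 0, 0, 0, 0], ![0, 1, 0, 0, 0], ![0, 0, 0, 1, 0], ![0, 0, 1, 0, 0],
        ![0, 0, 0, 0, 1]])
  rcases ne_or_eq a₁₄ 0 with h | rfl
  · exact of_iso (b₁₃ := 0) (b₁₄ := 0) (b₂₃ := 0) (b₂₄ := -a₂₄) (b₃₄ := -a₂₃) h
      (.of_basis ![![1, 0, 0, 0, 0], ![0, 1, 0, 0, 0], ![0, 0, 0, 0, 1], ![0, 0, 0, 1, 0],
        ![0, 0, 1, 0, 0]])
  simpa using hZ.coord_eq_zero ![0, 1, 0, 0, 0] 1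

theorem iso_M1_of_ne_zero {a₁₂ a₁₃ a₁₄ a₂₃ a₂₄ a₃₄ : ℂ} (h : a₃₄ ≠ 0) :
    Iso (pr (1 : Fin 5) 2 3 + cen5 a₁₂ a₁₃ a₁₄ a₂₃ a₂₄ a₃₄) (pr (1 : Fin 5) 2 3 + pr 3 4 5) := by
  obtain ⟨p₁₂, rfl⟩ := mul_right_surjective₀ h a₁₂
  obtain ⟨p₁₃, rfl⟩ := mul_right_surjective₀ h a₁₃
  obtain ⟨p₁₄, rfl⟩ := mul_right_surjective₀ h a₁₄
  obtain ⟨p₂₃, rfl⟩ := mul_right_surjective₀ h a₂₃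
  obtain ⟨p₂₄, rfl⟩ := mul_right_surjective₀ h a₂₄
  exact .of_basis ![![a₃₄, 0, 0, 0, 0], ![0, 1, 0, -p₁₄, p₁₃], ![0, 0, 1, -p₂₄, p₂₃],
    ![a₃₄ * (p₁₂ + p₂₃ * p₁₄ - p₁₃ * p₂₄), 0, 0, 1, 0], ![0, 0, 0, 0, 1]]

theorem iso_L5_of_ne_zero {a₁₂ a₁₃ a₁₄ a₂₃ a₂₄ : ℂ} (h : a₁₃ ≠ 0)
    (hZ : AnnLeSq (pr (1 : Fin 5) 2 3 + cen5 a₁₂ a₁₃ a₁₄ a₂₃ a₂₄ 0)) :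
    Iso (pr (1 : Fin 5) 2 3 + cen5 a₁₂ a₁₃ a₁₄ a₂₃ a₂₄ 0)
      (pr (1 : Fin 5) 2 3 + pr 1 3 5 + pr 2 4 5) := by
  obtain ⟨p₁₄, rfl⟩ := mul_right_surjective₀ h a₁₄
  obtain ⟨p₂₃, rfl⟩ := mul_right_surjective₀ h a₂₃
  obtain ⟨d, rfl⟩ : ∃ d, a₂₄ = a₁₃ * (d + p₂₃ * p₁₄) := by
    obtain ⟨p₂₄, rfl⟩ := mul_right_surjective₀ h a₂₄
    exact ⟨p₂₄ - p₂₃ * p₁₄, by ring⟩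
  rcases ne_or_eq d 0 with hd | rfl
  · exact .of_basis ![![a₁₃ * d ^ 2, 0, 0, 0, 0], ![0, d, 0, 0, 0], ![0, -p₂₃, 1, 0, 0],
      ![a₁₂ * d, 0, 0, d, 0], ![0, 0, 0, -p₁₄ * d, d]]
  · simpa using hZ.coord_eq_zero ![0, 0, 0, -p₁₄, 1] 4

theorem classified_L2_add_cen5 (a₁₂ a₁₃ a₁₄ a₂₃ a₂₄ a₃₄ : ℂ) :
    Classified Listed5 (pr 1 2 3 + cen5 a₁₂ a₁₃ a₁₄ a₂₃ a₂₄ a₃₄) := by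
  intro _ hZ
  rcases ne_or_eq a₃₄ 0 with h | rfl
  · exact ⟨_, .M1, iso_M1_of_ne_zero h⟩
  rcases ne_or_eq a₁₃ 0 with h | rfl
  · exact ⟨_, .L5, iso_L5_of_ne_zero h hZ⟩
  rcases ne_or_eq a₂₃ 0 with h | rfl
  · have e : Iso (pr (1 : Fin 5) 2 3 + cen5 a₁₂ 0 a₁₄ a₂₃ a₂₄ 0)
        (pr 1 2 3 + cen5 (-a₁₂) (-a₂₃) a₂₄ 0 a₁₄ 0) :=
      .of_basis ![![1, 0, 0, 0, 0], ![0, 0, 1, 0, 0], ![0, 1, 0, 0, 0], ![0, 0, 0, -1, 0],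
        ![0, 0, 0, 0, 1]]
    exact ⟨_, .L5, e.trans (iso_L5_of_ne_zero (neg_ne_zero.2 h) (e.annLeSq hZ))⟩
  rcases ne_or_eq a₁₄ 0 with h | rfl
  · exact ⟨_, .L8, .of_basis ![![a₁₄, 0, 0, 0, 0], ![0, 1, 0, 0, 0], ![0, -a₂₄ / a₁₄, 1, 0, 0],
      ![0, 0, 0, 0, 1], ![a₁₂, 0, 0, 1, 0]]⟩
  rcases ne_or_eq a₂₄ 0 with h | rfl
  · exact ⟨_, .L8, .of_basis ![![a₂₄, 0, 0, 0, 0], ![0, 0, 1, 0, 0], ![0, 1, 0, 0, 0],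
      ![0, 0, 0, 0, 1], ![-a₁₂, 0, 0, -1, 0]]⟩
  simpa using hZ.coord_eq_zero ![0, 0, 0, 0, 1] 4

theorem coeffs_eq_zero_of_isMalcev_L3_add_cen5 {a₁₂ a₁₃ a₁₄ a₂₃ a₂₄ a₃₄ : ℂ}
    (hM : IsMalcev (pr (1 : Fin 5) 2 3 + pr 1 3 4 + cen5 a₁₂ a₁₃ a₁₄ a₂₃ a₂₄ a₃₄)) :
    a₂₄ = 0 ∧ a₃₄ = 0 :=
  ⟨by simpa [jac, pr_apply] using
      congrFun (hM.2 (Pi.single 1 1) (Pi.single 2 1) (Pi.single 2 1)) 0,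
    by simpa [jac, pr_apply] using
      congrFun (hM.2 (Pi.single 1 1) (Pi.single 2 1) (Pi.single 3 1)) 0⟩

theorem classified_L3_add_cen5 (a₁₂ a₁₃ a₁₄ a₂₃ a₂₄ a₃₄ : ℂ) :
    Classified Listed5 (pr 1 2 3 + pr 1 3 4 + cen5 a₁₂ a₁₃ a₁₄ a₂₃ a₂₄ a₃₄) := by
  intro hM hZ
  obtain ⟨rfl, rfl⟩ := coeffs_eq_zero_of_isMalcev_L3_add_cen5 hM
  rcases ne_or_eq a₁₄ 0 with h | rfl <;> rcases ne_or_eq a₂₃ 0 with h' | rfl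
  · exact ⟨_, .L6, .of_basis ![![a₂₃ ^ 4 * a₁₄ ^ 2, 0, 0, 0, 0], ![0, a₂₃, 0, 0, 0],
      ![0, 0, a₂₃ * a₁₄, 0, 0], ![a₂₃ ^ 2 * a₁₄ * a₁₂, 0, 0, a₂₃ ^ 2 * a₁₄, 0],
      ![a₂₃ ^ 3 * a₁₄ * a₁₃, 0, 0, 0, a₂₃ ^ 3 * a₁₄]]⟩
  · exact ⟨_, .L7, .of_basis ![![a₁₄, 0, 0, 0, 0], ![0, 1, 0, 0, 0],
      ![0, 0, 1, 0, 0], ![a₁₂, 0, 0, 1, 0], ![a₁₃, 0, 0, 0, 1]]⟩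
  · exact ⟨_, .L9, .of_basis ![![a₂₃, 0, 0, 0, 0], ![0, 1, 0, 0, 0],
      ![0, 0, 1, 0, 0], ![a₁₂, 0, 0, 1, 0], ![a₁₃, 0, 0, 0, 1]]⟩
  · simpa [Fin.sum_univ_succ] using
      hZ.dotProduct_eq_zero ![1, 0, 0, 0, 0] ![1, 0, 0, -a₁₂, -a₁₃]

theorem isComplete_five : IsComplete.{u} 5 Listed5 := by
  have h₂ : extend (pr (1 : Fin 4) 2 3) 0 = pr 1 2 3 := extend_pr _ _ _
  have h₃ : extend (pr (1 : Fin 4) 2 3 + pr 1 3 4) 0 = pr 1 2 3 + pr 1 3 4 := by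
    simp only [extend_add, extend_pr]
    rfl
  refine isComplete_four.succ ?_ ?_
  · rintro _ (_ | _ | _)
    · rw [extend_zero]
      exact .zero
    · rw [h₂]
      exact .L2
    · rw [h₃]
      exact .L3
  · intro B hB θ hθ
    obtain ⟨a₁₂, a₁₃, a₁₄, a₂₃, a₂₄, a₃₄, h⟩ := exists_extend_eq_five B hθ
    rw [h]
    cases hB with
    | zero =>
      rw [extend_zero, zero_add]
      exact classified_cen5 a₁₂ a₁₃ a₁₄ a₂₃ a₂₄ a₃₄
    | L2 =>
      rw [h₂]
      exact classified_L2_add_cen5 a₁₂ a₁₃ a₁₄ a₂₃ a₂₄ a₃₄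
    | L3 =>
      rw [h₃]
      exact classified_L3_add_cen5 a₁₂ a₁₃ a₁₄ a₂₃ a₂₄ a₃₄

end LowDimension

section DimensionSix

/-- The products of a six-dimensional algebra with values in the line of `e₆`. -/
def cen (a₁₂ a₁₃ a₁₄ a₁₅ a₂₃ a₂₄ a₂₅ a₃₄ a₃₅ a₄₅ : ℂ) : Alg (Fin 6 → ℂ) :=
  a₁₂ • prd 1 2 6 + a₁₃ • prd 1 3 6 + a₁₄ • prd 1 4 6 + a₁₅ • prd 1 5 6 + a₂₃ • prd 2 3 6 +
    a₂₄ • prd 2 4 6 + a₂₅ • prd 2 5 6 + a₃₄ • prd 3 4 6 + a₃₅ • prd 3 5 6 + a₄₅ • prd 4 5 6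

@[simp]
theorem cen_apply (a₁₂ a₁₃ a₁₄ a₁₅ a₂₃ a₂₄ a₂₅ a₃₄ a₃₅ a₄₅ : ℂ) (x y : Fin 6 → ℂ) (l : Fin 6) :
    cen a₁₂ a₁₃ a₁₄ a₁₅ a₂₃ a₂₄ a₂₅ a₃₄ a₃₅ a₄₅ x y l = if l = 0 then
      a₁₂ * (x 1 * y 2 - x 2 * y 1) + a₁₃ * (x 1 * y 3 - x 3 * y 1) +
      a₁₄ * (x 1 * y 4 - x 4 * y 1) + a₁₅ * (x 1 * y 5 - x 5 * y 1) +
      a₂₃ * (x 2 * y 3 - x 3 * y 2) + a₂₄ * (x 2 * y 4 - x 4 * y 2) +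
      a₂₅ * (x 2 * y 5 - x 5 * y 2) + a₃₄ * (x 3 * y 4 - x 4 * y 3) +
      a₃₅ * (x 3 * y 5 - x 5 * y 3) + a₄₅ * (x 4 * y 5 - x 5 * y 4) else 0 := by
  simp only [cen, LinearMap.add_apply, LinearMap.smul_apply, Pi.add_apply, Pi.smul_apply,
    prd_apply, smul_eq_mul, show (6 : Fin 6) = 0 from rfl]
  split_ifs <;> ring

theorem exists_extend_eq_six (B : Alg (Fin 5 → ℂ)) {θ : LinearMap.BilinForm ℂ (Fin 5 → ℂ)}
    (hθ : ∀ x y, θ x y = -θ y x) : ∃ a₁₂ a₁₃ a₁₄ a₁₅ a₂₃ a₂₄ a₂₅ a₃₄ a₃₅ a₄₅ : ℂ,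
      extend B θ = extend B 0 + cen a₁₂ a₁₃ a₁₄ a₁₅ a₂₃ a₂₄ a₂₅ a₃₄ a₃₅ a₄₅ := by
  obtain ⟨t, ht, h⟩ := exists_skew_matrix hθ
  refine ⟨t 1 2, t 1 3, t 1 4, t 1 0, t 2 3, t 2 4, t 2 0, t 3 4, t 3 0, t 4 0,
    LinearMap.ext₂ fun x y => funext fun j => ?_⟩
  simp only [Fin.forall_fin_succ] at ht
  revert j
  simp [Fin.forall_fin_succ, Fin.sum_univ_succ, extend_apply, h, up] at ht ⊢
  grind

variable {μ ν : Alg (Fin 6 → ℂ)} {a₁₂ a₁₃ a₁₄ a₁₅ a₂₃ a₂₄ a₂₅ a₃₄ a₃₅ a₄₅ : ℂ}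

theorem Classified.of_iso {D : Alg (Fin 6 → ℂ) → Prop} (h : Classified D ν) (e : Iso μ ν) :
    Classified D μ := fun hM hZ => by
  obtain ⟨ξ, hξ, e'⟩ := h (e.isMalcev hM) (e.annLeSq hZ)
  exact ⟨ξ, hξ, e.trans e'⟩

theorem IsListed.classified (h : IsListed ν) (e : Iso μ ν) : Classified IsListed μ :=
  fun _ _ => ⟨ν, h, e⟩

theorem classified_L2_add_cen_of_a₃₄_eq_one (b₁₅ b₂₅ : ℂ) :
    Classified IsListed (prd 1 2 3 + cen 0 0 0 b₁₅ 0 0 b₂₅ 1 0 0) := by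
  rcases ne_or_eq b₁₅ 0 with h | rfl
  · exact IsListed.M5.classified (.of_basis ![![b₁₅, 0, 0, 0, 0, 0], ![0, 1, 0, 0, 0, 0],
      ![0, -b₂₅, b₁₅, 0, 0, 0], ![0, 0, 0, b₁₅, 0, 0], ![0, 0, 0, 0, 1, 0], ![0, 0, 0, 0, 0, 1]])
  rcases ne_or_eq b₂₅ 0 with h | rfl
  · exact IsListed.M5.classified (.of_basis ![![b₂₅, 0, 0, 0, 0, 0], ![0, 0, 1, 0, 0, 0],
      ![0, 1, 0, 0, 0, 0], ![0, 0, 0, -1, 0, 0], ![0, 0, 0, 0, -b₂₅, 0], ![0, 0, 0, 0, 0, 1]])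
  intro _ hZ
  simpa using hZ.coord_eq_zero ![0, 0, 0, 0, 0, 1] 5

theorem classified_L2_add_cen_of_a₃₄_ne_zero (h : a₃₄ ≠ 0) :
    Classified IsListed (prd 1 2 3 + cen a₁₂ a₁₃ a₁₄ a₁₅ a₂₃ a₂₄ a₂₅ a₃₄ a₃₅ a₄₅) := by
  obtain ⟨p₁₂, rfl⟩ := mul_right_surjective₀ h a₁₂
  obtain ⟨p₁₃, rfl⟩ := mul_right_surjective₀ h a₁₃
  obtain ⟨p₁₄, rfl⟩ := mul_right_surjective₀ h a₁₄
  obtain ⟨p₁₅, rfl⟩ := mul_right_surjective₀ h a₁₅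
  obtain ⟨p₂₃, rfl⟩ := mul_right_surjective₀ h a₂₃
  obtain ⟨p₂₄, rfl⟩ := mul_right_surjective₀ h a₂₄
  obtain ⟨p₂₅, rfl⟩ := mul_right_surjective₀ h a₂₅
  obtain ⟨p₃₅, rfl⟩ := mul_right_surjective₀ h a₃₅
  obtain ⟨p₄₅, rfl⟩ := mul_right_surjective₀ h a₄₅
  exact (classified_L2_add_cen_of_a₃₄_eq_one (p₁₅ + p₁₃ * p₄₅ - p₁₄ * p₃₅)
    (p₂₅ + p₂₃ * p₄₅ - p₂₄ * p₃₅)).of_iso (.of_basis ![![a₃₄, 0, 0, 0, 0, 0],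
      ![0, 1, 0, -p₁₄, p₁₃, 0], ![0, 0, 1, -p₂₄, p₂₃, 0],
      ![a₃₄ * (p₁₂ + p₁₄ * p₂₃ - p₁₃ * p₂₄), 0, 0, 1, 0, 0], ![0, 0, 0, 0, 1, 0],
      ![0, 0, 0, p₄₅, -p₃₅, 1]])

theorem classified_L2_add_cen_of_a₁₃_eq_one (b₂₄ b₂₅ b₄₅ : ℂ) :
    Classified IsListed (prd 1 2 3 + cen 0 1 0 0 0 b₂₄ b₂₅ 0 0 b₄₅) := by
  rcases ne_or_eq b₄₅ 0 with h | rfl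
  · exact IsListed.L10.classified (.of_basis ![![1, 0, 0, 0, 0, 0], ![0, 1, 0, 0, 0, 0],
      ![0, 0, 1, 0, -b₂₅ / b₄₅, b₂₄ / b₄₅], ![0, 0, 0, 1, 0, 0], ![0, 0, 0, 0, 1, 0],
      ![0, 0, 0, 0, 0, b₄₅⁻¹]])
  intro _ hZ
  obtain rfl : b₂₅ = 0 := by simpa using hZ.coord_eq_zero ![0, 0, 0, 0, b₂₅, -b₂₄] 4
  obtain rfl : b₂₄ = 0 := by simpa using hZ.coord_eq_zero ![0, 0, 0, 0, 0, -b₂₄] 5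
  simpa using hZ.coord_eq_zero ![0, 0, 0, 0, 0, 1] 5

theorem classified_L2_add_cen_of_a₁₃_ne_zero (h : a₁₃ ≠ 0) :
    Classified IsListed (prd 1 2 3 + cen a₁₂ a₁₃ a₁₄ a₁₅ a₂₃ a₂₄ a₂₅ 0 0 a₄₅) := by
  obtain ⟨p₁₄, rfl⟩ := mul_right_surjective₀ h a₁₄
  obtain ⟨p₁₅, rfl⟩ := mul_right_surjective₀ h a₁₅
  obtain ⟨p₂₃, rfl⟩ := mul_right_surjective₀ h a₂₃
  obtain ⟨p₂₄, rfl⟩ := mul_right_surjective₀ h a₂₄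
  obtain ⟨p₂₅, rfl⟩ := mul_right_surjective₀ h a₂₅
  obtain ⟨p₄₅, rfl⟩ := mul_right_surjective₀ h a₄₅
  exact (classified_L2_add_cen_of_a₁₃_eq_one (p₂₄ - p₁₄ * p₂₃) (p₂₅ - p₁₅ * p₂₃) p₄₅).of_iso
    (.of_basis ![![a₁₃, 0, 0, 0, 0, 0], ![0, 1, 0, 0, 0, 0], ![0, -p₂₃, 1, 0, 0, 0],
      ![a₁₂, 0, 0, 1, 0, 0], ![0, 0, 0, -p₁₄, 1, 0], ![0, 0, 0, -p₁₅, 0, 1]])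

theorem classified_L2_add_cen_of_central_e₃ :
    Classified IsListed (prd 1 2 3 + cen a₁₂ 0 a₁₄ a₁₅ 0 a₂₄ a₂₅ 0 0 a₄₅) := by
  rcases ne_or_eq a₄₅ 0 with h | rfl
  · obtain ⟨p₁₂, rfl⟩ := mul_right_surjective₀ h a₁₂
    obtain ⟨p₁₄, rfl⟩ := mul_right_surjective₀ h a₁₄
    obtain ⟨p₁₅, rfl⟩ := mul_right_surjective₀ h a₁₅
    obtain ⟨p₂₄, rfl⟩ := mul_right_surjective₀ h a₂₄
    obtain ⟨p₂₅, rfl⟩ := mul_right_surjective₀ h a₂₅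
    suffices normalized : Classified IsListed (prd 1 2 3 + cen 0 0 0 0 0 0 0 0 0 1) from
      normalized.of_iso (.of_basis ![![a₄₅, 0, 0, 0, 0, 0], ![0, 1, 0, 0, -p₁₅, p₁₄],
        ![0, 0, 1, 0, -p₂₅, p₂₄], ![a₄₅ * (p₁₂ - p₂₅ * p₁₄ + p₂₄ * p₁₅), 0, 0, 1, 0, 0],
        ![0, 0, 0, 0, 1, 0], ![0, 0, 0, 0, 0, 1]])
    exact IsListed.L22b.classified (.of_basis ![![-1, 0, 0, 1, 0, 0], ![0, 1, 0, 0, 1, 0],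
      ![0, 0, 1, 0, 0, 1], ![0, 0, 1, 0, 0, -1], ![0, -1, 0, 0, 1, 0], ![1, 0, 0, 1, 0, 0]])
  obtain ⟨d, hd⟩ : ∃ d, d = a₁₄ * a₂₅ - a₁₅ * a₂₄ := ⟨_, rfl⟩
  rcases ne_or_eq d 0 with h | rfl
  · exact IsListed.L22a.classified (.of_basis ![![a₁₂, 0, 0, 1, 0, 0], ![0, 1, 0, 0, 0, 0],
      ![0, 0, 0, 0, a₂₅, -a₂₄], ![0, 0, 1, 0, 0, 0], ![0, 0, 0, 0, -a₁₅, a₁₄],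
      ![d, 0, 0, 0, 0, 0]])
  intro _ hZ
  obtain rfl : a₂₅ = 0 := by simpa using hZ.coord_eq_zero ![0, 0, 0, 0, a₂₅, -a₂₄] 4
  obtain rfl : a₁₅ = 0 := by simpa using hZ.coord_eq_zero ![0, 0, 0, 0, a₁₅, -a₁₄] 4
  simpa using hZ.coord_eq_zero ![0, 0, 0, 0, 0, 1] 5

theorem classified_L2_add_cen :
    Classified IsListed (prd 1 2 3 + cen a₁₂ a₁₃ a₁₄ a₁₅ a₂₃ a₂₄ a₂₅ a₃₄ a₃₅ a₄₅) := by
  rcases ne_or_eq a₃₄ 0 with h | rfl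
  · exact classified_L2_add_cen_of_a₃₄_ne_zero h
  rcases ne_or_eq a₃₅ 0 with h | rfl
  · exact Classified.of_iso (ν := prd 1 2 3 + cen a₁₂ a₁₃ a₁₅ a₁₄ a₂₃ a₂₅ a₂₄ a₃₅ 0 (-a₄₅))
      (classified_L2_add_cen_of_a₃₄_ne_zero h)
      (.of_basis ![![1, 0, 0, 0, 0, 0], ![0, 1, 0, 0, 0, 0], ![0, 0, 1, 0, 0, 0],
        ![0, 0, 0, 1, 0, 0], ![0, 0, 0, 0, 0, 1], ![0, 0, 0, 0, 1, 0]])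
  rcases ne_or_eq a₁₃ 0 with h | rfl
  · exact classified_L2_add_cen_of_a₁₃_ne_zero h
  rcases ne_or_eq a₂₃ 0 with h | rfl
  · exact Classified.of_iso (ν := prd 1 2 3 + cen (-a₁₂) (-a₂₃) a₂₄ a₂₅ 0 a₁₄ a₁₅ 0 0 a₄₅)
      (classified_L2_add_cen_of_a₁₃_ne_zero (neg_ne_zero.2 h))
      (.of_basis ![![1, 0, 0, 0, 0, 0], ![0, 0, 1, 0, 0, 0], ![0, 1, 0, 0, 0, 0],
        ![0, 0, 0, -1, 0, 0], ![0, 0, 0, 0, 1, 0], ![0, 0, 0, 0, 0, 1]])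
  exact classified_L2_add_cen_of_central_e₃

theorem classified_L3_add_cen_of_a₁₄_ne_zero (h : a₁₄ ≠ 0) :
    Classified IsListed (prd 1 2 3 + prd 1 3 4 + cen 0 0 a₁₄ a₁₅ a₂₃ 0 a₂₅ 0 a₃₅ 0) := by
  rcases ne_or_eq a₃₅ 0 with h' | rfl
  · exact IsListed.M6.classified (.of_basis ![![a₁₄, 0, 0, 0, 0, 0], ![0, 1, 0, 0, 0, 0],
      ![0, 0, 1, -a₂₅ / a₃₅, 0, a₂₃ / a₃₅], ![a₂₃ / a₃₅ * a₁₅, 0, 0, 1, -a₂₅ / a₃₅, 0],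
      ![-a₂₅ / a₃₅ * a₁₄, 0, 0, 0, 1, 0], ![0, 0, 0, 0, -a₁₅ / a₃₅, a₁₄ / a₃₅]])
  rcases ne_or_eq a₂₅ 0 with h' | rfl
  · rcases ne_or_eq a₂₃ 0 with h'' | rfl
    · exact IsListed.L11.classified (.of_basis ![![a₂₃ ^ 4 * a₁₄ ^ 2, 0, 0, 0, 0, 0],
        ![0, a₂₃, 0, 0, 0, 0], ![0, 0, a₂₃ * a₁₄, 0, 0, 0], ![0, 0, 0, a₂₃ ^ 2 * a₁₄, 0, 0],
        ![0, 0, 0, 0, a₂₃ ^ 3 * a₁₄, 0],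
        ![0, 0, 0, 0, -a₁₅ * a₂₃ ^ 3 / a₂₅, a₁₄ * a₂₃ ^ 3 / a₂₅]])
    · exact IsListed.L12.classified (.of_basis ![![a₁₄, 0, 0, 0, 0, 0],
        ![0, 1, 0, 0, 0, 0], ![0, 0, 1, 0, 0, 0], ![0, 0, 0, 1, 0, 0],
        ![0, 0, 0, 0, 1, 0], ![0, 0, 0, 0, -a₁₅ / a₂₅, a₁₄ / a₂₅]])
  intro _ hZ
  simpa [h] using hZ.coord_eq_zero ![0, 0, 0, 0, -a₁₅, a₁₄] 5

theorem classified_L3_add_cen_of_central_e₄ :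
    Classified IsListed (prd 1 2 3 + prd 1 3 4 + cen 0 0 0 a₁₅ a₂₃ 0 a₂₅ 0 a₃₅ 0) := by
  rcases ne_or_eq a₃₅ 0 with h | rfl
  · obtain ⟨p₁₅, rfl⟩ := mul_right_surjective₀ h a₁₅
    obtain ⟨p₂₃, rfl⟩ := mul_right_surjective₀ h a₂₃
    obtain ⟨p₂₅, rfl⟩ := mul_right_surjective₀ h a₂₅
    exact IsListed.M2.classified (.of_basis ![![0, 0, 0, 0, 1, 0], ![0, 1, 0, -p₁₅, 0, 0],
      ![0, 0, 1, -p₂₅, 0, p₂₃], ![a₃₅ * p₁₅ * p₂₃, 0, 0, 1, -p₂₅, 0], ![0, 0, 0, 0, 0, 1],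
      ![a₃₅, 0, 0, 0, 0, 0]])
  rcases ne_or_eq a₂₅ 0 with h | rfl
  · obtain ⟨p₁₅, rfl⟩ := mul_right_surjective₀ h a₁₅
    rcases ne_or_eq a₂₃ 0 with h' | rfl
    · exact IsListed.L24b.classified (.of_basis ![
        ![2 * a₂₅ * p₁₅ * a₂₃ + 2 * a₂₅ ^ 2 * a₂₃, 0, 0, 0, -2 * a₂₅, 0],
        ![0, 1, a₂₅ - p₁₅, 0, 0, 0], ![0, 1, -a₂₅ - p₁₅, 0, 0, 0], ![0, 0, 0, -2 * a₂₅, 0, 0],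
        ![0, 0, 0, -2 * a₂₅, 0, 4 * a₂₃],
        ![2 * a₂₅ * p₁₅ * a₂₃ - 2 * a₂₅ ^ 2 * a₂₃, 0, 0, 0, -2 * a₂₅, 0]])
    · exact IsListed.L19a.classified (.of_basis ![![0, 0, 0, 0, -1, 0], ![0, 0, 1, 0, 0, 0],
        ![0, 1, -p₁₅, 0, 0, 0], ![0, 0, 0, 0, 0, 1], ![0, 0, 0, -1, 0, 0],
        ![a₂₅, 0, 0, 0, 0, 0]])
  rcases ne_or_eq a₁₅ 0 with h | rfl
  · rcases ne_or_eq a₂₃ 0 with h' | rfl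
    · exact IsListed.L24a.classified (.of_basis ![![0, 0, 0, 0, -1, 0], ![0, 0, 1, 0, 0, 0],
        ![0, 1, 0, 0, 0, 0], ![0, 0, 0, -1, 0, 0], ![0, 0, 0, 0, 0, -a₂₃ / a₁₅],
        ![-a₂₃, 0, 0, 0, 0, 0]])
    · exact IsListed.L25.classified (.of_basis ![![a₁₅, 0, 0, 0, 0, 0], ![0, 1, 0, 0, 0, 0],
        ![0, 0, 1, 0, 0, 0], ![0, 0, 0, 1, 0, 0], ![0, 0, 0, 0, 0, 1], ![0, 0, 0, 0, 1, 0]])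
  intro _ hZ
  simpa using hZ.coord_eq_zero ![0, 0, 0, 0, 0, 1] 5

theorem coeffs_eq_zero_of_isMalcev_L3_add_cen
    (hM : IsMalcev (prd 1 2 3 + prd 1 3 4 + cen a₁₂ a₁₃ a₁₄ a₁₅ a₂₃ a₂₄ a₂₅ a₃₄ a₃₅ a₄₅)) :
    a₂₄ = 0 ∧ a₃₄ = 0 ∧ a₄₅ = 0 :=
  ⟨by simpa [jac, prd_apply] using
      congrFun (hM.2 (Pi.single 1 1) (Pi.single 2 1) (Pi.single 2 1)) 0,
    by simpa [jac, prd_apply] using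
      congrFun (hM.2 (Pi.single 1 1) (Pi.single 2 1) (Pi.single 3 1)) 0,
    by simpa [jac, prd_apply] using
      congrFun (hM.2 (Pi.single 1 1) (Pi.single 5 1) (Pi.single 2 1)) 0⟩

theorem classified_L3_add_cen :
    Classified IsListed (prd 1 2 3 + prd 1 3 4 + cen a₁₂ a₁₃ a₁₄ a₁₅ a₂₃ a₂₄ a₂₅ a₃₄ a₃₅ a₄₅) := by
  intro hM
  obtain ⟨rfl, rfl, rfl⟩ := coeffs_eq_zero_of_isMalcev_L3_add_cen hM
  suffices normalized :
      Classified IsListed (prd 1 2 3 + prd 1 3 4 + cen 0 0 a₁₄ a₁₅ a₂₃ 0 a₂₅ 0 a₃₅ 0) from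
    normalized.of_iso (.of_basis ![![1, 0, 0, 0, 0, 0], ![0, 1, 0, 0, 0, 0], ![0, 0, 1, 0, 0, 0],
      ![a₁₂, 0, 0, 1, 0, 0], ![a₁₃, 0, 0, 0, 1, 0], ![0, 0, 0, 0, 0, 1]]) hM
  rcases ne_or_eq a₁₄ 0 with h | rfl
  · exact classified_L3_add_cen_of_a₁₄_ne_zero h
  · exact classified_L3_add_cen_of_central_e₄

theorem coeff_eq_zero_of_isMalcev_L8_add_cen
    (hM : IsMalcev (prd 1 2 4 + prd 1 3 5 + cen a₁₂ a₁₃ a₁₄ a₁₅ a₂₃ a₂₄ a₂₅ a₃₄ a₃₅ a₄₅)) :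
    a₄₅ = 0 := by
  simpa [jac, prd_apply] using congrFun (hM.2 (Pi.single 1 1) (Pi.single 2 1) (Pi.single 3 1)) 0

theorem classified_L8_add_cen_of_block_eq_zero_of_a₁₄_ne_zero (h : a₁₄ ≠ 0) :
    Classified IsListed (prd 1 2 4 + prd 1 3 5 + cen 0 0 a₁₄ a₁₅ a₂₃ 0 0 0 0 0) := by
  obtain ⟨p₁₅, rfl⟩ := mul_right_surjective₀ h a₁₅
  rcases ne_or_eq a₂₃ 0 with h' | rfl
  · exact IsListed.L23.classified (.of_basis ![![0, 0, 0, 0, -p₁₅ * a₁₄ / a₂₃, a₁₄ / a₂₃],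
      ![0, 1, 0, 0, 0, 0], ![0, 0, 1, 0, 0, 0], ![0, 0, 0, 0, 1, 0],
      ![0, 0, -p₁₅ * a₁₄ / a₂₃, a₁₄ / a₂₃, 0, 0], ![a₁₄, 0, 0, 0, 0, 0]])
  · exact IsListed.L25.classified (.of_basis ![![0, 0, 0, 0, -p₁₅, 1],
      ![0, 1, 0, 0, 0, 0], ![0, 0, 1, 0, 0, 0], ![0, 0, 0, 0, 1, 0],
      ![0, 0, -p₁₅, 1, 0, 0], ![a₁₄, 0, 0, 0, 0, 0]])

theorem classified_L8_add_cen_of_block_eq_zero :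
    Classified IsListed (prd 1 2 4 + prd 1 3 5 + cen 0 0 a₁₄ a₁₅ a₂₃ 0 0 0 0 0) := by
  rcases ne_or_eq a₁₄ 0 with h | rfl
  · exact classified_L8_add_cen_of_block_eq_zero_of_a₁₄_ne_zero h
  rcases ne_or_eq a₁₅ 0 with h | rfl
  · exact Classified.of_iso (ν := prd 1 2 4 + prd 1 3 5 + cen 0 0 a₁₅ 0 (-a₂₃) 0 0 0 0 0)
      (classified_L8_add_cen_of_block_eq_zero_of_a₁₄_ne_zero h)
      (.of_basis ![![1, 0, 0, 0, 0, 0], ![0, 1, 0, 0, 0, 0], ![0, 0, 0, 1, 0, 0],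
        ![0, 0, 1, 0, 0, 0], ![0, 0, 0, 0, 0, 1], ![0, 0, 0, 0, 1, 0]])
  rcases ne_or_eq a₂₃ 0 with h | rfl
  · exact IsListed.L26.classified (.of_basis ![![a₂₃, 0, 0, 0, 0, 0],
      ![0, 1, 0, 0, 0, 0], ![0, 0, 1, 0, 0, 0], ![0, 0, 0, 1, 0, 0], ![0, 0, 0, 0, 1, 0],
      ![0, 0, 0, 0, 0, 1]])
  intro _ hZ
  simpa using hZ.coord_eq_zero ![1, 0, 0, 0, 0, 0] 0

theorem classified_L8_add_cen_of_block_skew {k : ℂ} (h : k ≠ 0) :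
    Classified IsListed (prd 1 2 4 + prd 1 3 5 + cen 0 0 a₁₄ a₁₅ a₂₃ 0 k (-k) 0 0) := by
  obtain ⟨p₁₄, rfl⟩ := mul_right_surjective₀ h a₁₄
  obtain ⟨p₁₅, rfl⟩ := mul_right_surjective₀ h a₁₅
  obtain ⟨p₂₃, rfl⟩ := mul_right_surjective₀ h a₂₃
  exact IsListed.M8.classified (.of_basis ![![k, 0, 0, 0, 0, 0], ![0, 1, -p₁₅, p₁₄, 0, 0],
    ![0, 0, 1, 0, -p₂₃, 0], ![0, 0, 0, 1, 0, 0], ![-k * p₁₄ * p₂₃, 0, 0, 0, 1, 0],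
    ![-k * p₁₅ * p₂₃, 0, 0, 0, 0, 1]])

theorem classified_L8_add_cen_of_skewPart_eq_one {α : ℂ} :
    Classified IsListed (prd 1 2 4 + prd 1 3 5 + cen 0 0 a₁₄ a₁₅ a₂₃ 1 1 (-1) α 0) := by
  rcases ne_or_eq α (-1) with h | rfl
  · have h' : 1 + α ≠ 0 := fun h' => h (by linear_combination h')
    obtain ⟨t, ht⟩ : ∃ t, t * (1 + α) = a₁₄ - a₁₅ := ⟨(a₁₄ - a₁₅) / (1 + α), by field_simp⟩
    obtain rfl : a₁₅ = a₁₄ - t * (1 + α) := by rw [ht]; ring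
    exact (IsListed.M7 α h).classified (.of_basis ![![1, 0, 0, 0, 0, 0],
      ![0, 1, t - a₁₄, t, 0, 0], ![0, 0, 1, 0, -a₂₃, 0], ![0, 0, 0, 1, 0, 0],
      ![-t * a₂₃, 0, 0, 0, 1, 0], ![(t - a₁₄) * a₂₃, 0, 0, 0, 0, 1]])
  obtain ⟨b, rfl⟩ : ∃ b, a₁₄ = a₁₅ + b := ⟨a₁₄ - a₁₅, by ring⟩
  rcases ne_or_eq b 0 with h | rfl
  · exact IsListed.M9.classified (.of_basis ![![b, 0, 0, 0, 0, 0],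
      ![0, 1, -(2 * a₁₅ + b) / 4, (2 * a₁₅ + b) / 4, 0, 0], ![0, 0, 1, -1, 0, 0],
      ![0, 0, b / 4, b / 4, -a₂₃ * b / 8, -a₂₃ * b / 8], ![0, 0, 0, 0, 1, -1],
      ![-(2 * a₁₅ + b) * a₂₃ * b / 8, 0, 0, 0, b / 4, b / 4]])
  · exact IsListed.M3.classified (.of_basis ![![0, 0, 0, 0, 1, -1],
      ![0, 1, -a₁₅ / 2, a₁₅ / 2, 0, 0], ![0, 0, 1, 1, -a₂₃ / 2, -a₂₃ / 2],
      ![-a₁₅ * a₂₃, 0, 0, 0, 1, 1], ![0, 0, 1, -1, 0, 0], ![-4, 0, 0, 0, 0, 0]])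

theorem classified_L8_add_cen_of_skewPart_eq_zero {d : ℂ} :
    Classified IsListed (prd 1 2 4 + prd 1 3 5 + cen 0 0 a₁₄ a₁₅ a₂₃ 1 0 0 d 0) := by
  obtain ⟨r, rfl⟩ := IsAlgClosed.exists_pow_nat_eq d (n := 2) (by norm_num)
  rcases ne_or_eq r 0 with h | rfl
  · exact IsListed.L19b.classified (.of_basis ![![1, 0, 0, 0, 0, 0],
      ![0, 1, -a₁₄, -a₁₅ / r ^ 2, 0, 0], ![0, 0, 1, 0, 0, 0], ![0, 0, 0, 1 / r, -a₂₃ / r, 0],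
      ![a₁₅ / r ^ 2 * a₂₃, 0, 0, 0, 1, 0], ![-a₁₄ * a₂₃ / r, 0, 0, 0, 0, 1 / r]])
  rcases ne_or_eq a₁₅ 0 with h | rfl
  · exact IsListed.L20.classified (.of_basis ![![1, 0, 0, 0, 0, 0],
      ![0, 1, -a₁₄, 0, 0, 0], ![0, 0, 1, 0, 0, 0], ![0, 0, 0, 1 / a₁₅, -a₂₃ / a₁₅, 0],
      ![0, 0, 0, 0, 1, 0], ![-a₁₄ * a₂₃ / a₁₅, 0, 0, 0, 0, 1 / a₁₅]])
  · exact IsListed.L19a.classified (.of_basis ![![1, 0, 0, 0, 0, 0],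
      ![0, 1, -a₁₄, 0, 0, 0], ![0, 0, 1, 0, 0, 0], ![0, 0, 0, 1, -a₂₃, 0],
      ![0, 0, 0, 0, 1, 0], ![-a₁₄ * a₂₃, 0, 0, 0, 0, 1]])

theorem classified_L8_add_cen_of_a₂₄_eq_one {k d : ℂ} :
    Classified IsListed (prd 1 2 4 + prd 1 3 5 + cen 0 0 a₁₄ a₁₅ a₂₃ 1 k (-k) d 0) := by
  rcases ne_or_eq k 0 with h | rfl
  · exact Classified.of_iso
      (ν := prd 1 2 4 + prd 1 3 5 + cen 0 0 a₁₄ (a₁₅ / k) (a₂₃ / k) 1 1 (-1) (d / k ^ 2) 0)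
      classified_L8_add_cen_of_skewPart_eq_one
      (.of_basis ![![1, 0, 0, 0, 0, 0], ![0, 1, 0, 0, 0, 0], ![0, 0, 1, 0, 0, 0],
        ![0, 0, 0, 1 / k, 0, 0], ![0, 0, 0, 0, 1, 0], ![0, 0, 0, 0, 0, 1 / k]])
  · rw [neg_zero]
    exact classified_L8_add_cen_of_skewPart_eq_zero

/-- The values of `cen` on `{e₂, e₃} × {e₄, e₅}` form a matrix that changes by congruence under a
simultaneous change of `e₂, e₃` and `e₄, e₅`; hence its symmetric part can be diagonalized. -/
theorem classified_L8_add_cen_of_a₂₄_ne_zero (h : a₂₄ ≠ 0) :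
    Classified IsListed (prd 1 2 4 + prd 1 3 5 + cen 0 0 a₁₄ a₁₅ a₂₃ a₂₄ a₂₅ a₃₄ a₃₅ 0) := by
  obtain ⟨p₁₄, rfl⟩ := mul_right_surjective₀ h a₁₄
  obtain ⟨p₁₅, rfl⟩ := mul_right_surjective₀ h a₁₅
  obtain ⟨p₂₃, rfl⟩ := mul_right_surjective₀ h a₂₃
  obtain ⟨p₃₅, rfl⟩ := mul_right_surjective₀ h a₃₅
  obtain ⟨s, k, rfl, rfl⟩ : ∃ s k, a₂₅ = a₂₄ * (s + k) ∧ a₃₄ = a₂₄ * (s - k) := by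
    obtain ⟨p₂₅, rfl⟩ := mul_right_surjective₀ h a₂₅
    obtain ⟨p₃₄, rfl⟩ := mul_right_surjective₀ h a₃₄
    exact ⟨(p₂₅ + p₃₄) / 2, (p₂₅ - p₃₄) / 2, by ring, by ring⟩
  exact Classified.of_iso
    (ν := prd 1 2 4 + prd 1 3 5 + cen 0 0 p₁₄ (p₁₅ - s * p₁₄) p₂₃ 1 k (-k) (p₃₅ - s ^ 2) 0)
    classified_L8_add_cen_of_a₂₄_eq_one
    (.of_basis ![![a₂₄, 0, 0, 0, 0, 0], ![0, 1, 0, 0, 0, 0], ![0, 0, 1, 0, 0, 0],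
      ![0, 0, -s, 1, 0, 0], ![0, 0, 0, 0, 1, 0], ![0, 0, 0, 0, -s, 1]])

theorem classified_L8_add_cen_of_a₄₅_eq_zero :
    Classified IsListed (prd 1 2 4 + prd 1 3 5 + cen 0 0 a₁₄ a₁₅ a₂₃ a₂₄ a₂₅ a₃₄ a₃₅ 0) := by
  rcases ne_or_eq a₂₄ 0 with h | rfl
  · exact classified_L8_add_cen_of_a₂₄_ne_zero h
  rcases ne_or_eq a₃₅ 0 with h | rfl
  · exact Classified.of_iso
      (ν := prd 1 2 4 + prd 1 3 5 + cen 0 0 a₁₅ a₁₄ (-a₂₃) a₃₅ a₃₄ a₂₅ 0 0)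
      (classified_L8_add_cen_of_a₂₄_ne_zero h)
      (.of_basis ![![1, 0, 0, 0, 0, 0], ![0, 1, 0, 0, 0, 0], ![0, 0, 0, 1, 0, 0],
        ![0, 0, 1, 0, 0, 0], ![0, 0, 0, 0, 0, 1], ![0, 0, 0, 0, 1, 0]])
  rcases ne_or_eq (a₂₅ + a₃₄) 0 with h | h
  · exact Classified.of_iso
      (ν := prd 1 2 4 + prd 1 3 5 + cen 0 0 (a₁₄ + a₁₅) a₁₅ a₂₃ (a₂₅ + a₃₄) a₂₅ a₃₄ 0 0)
      (classified_L8_add_cen_of_a₂₄_ne_zero h)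
      (.of_basis ![![1, 0, 0, 0, 0, 0], ![0, 1, 0, 0, 0, 0], ![0, 0, 1, 1, 0, 0],
        ![0, 0, 0, 1, 0, 0], ![0, 0, 0, 0, 1, 1], ![0, 0, 0, 0, 0, 1]])
  obtain rfl : a₃₄ = -a₂₅ := by linear_combination h
  rcases ne_or_eq a₂₅ 0 with h | rfl
  · exact classified_L8_add_cen_of_block_skew h
  · rw [neg_zero]
    exact classified_L8_add_cen_of_block_eq_zero

theorem classified_L8_add_cen :
    Classified IsListed (prd 1 2 4 + prd 1 3 5 + cen a₁₂ a₁₃ a₁₄ a₁₅ a₂₃ a₂₄ a₂₅ a₃₄ a₃₅ a₄₅) := by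
  intro hM
  obtain rfl := coeff_eq_zero_of_isMalcev_L8_add_cen hM
  exact Classified.of_iso
    (ν := prd 1 2 4 + prd 1 3 5 + cen 0 0 a₁₄ a₁₅ a₂₃ a₂₄ a₂₅ a₃₄ a₃₅ 0)
    classified_L8_add_cen_of_a₄₅_eq_zero
    (.of_basis ![![1, 0, 0, 0, 0, 0], ![0, 1, 0, 0, 0, 0], ![0, 0, 1, 0, 0, 0],
      ![0, 0, 0, 1, 0, 0], ![a₁₂, 0, 0, 0, 1, 0], ![a₁₃, 0, 0, 0, 0, 1]]) hM

theorem coeffs_eq_zero_of_isMalcev_L5_add_cen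
    (hM : IsMalcev (prd 1 2 3 + prd 1 3 5 + prd 2 4 5 +
      cen a₁₂ a₁₃ a₁₄ a₁₅ a₂₃ a₂₄ a₂₅ a₃₄ a₃₅ a₄₅)) : a₂₅ = 0 ∧ a₃₅ = 0 ∧ a₄₅ = 0 :=
  ⟨by simpa [jac, prd_apply] using
      congrFun (hM.2 (Pi.single 1 1) (Pi.single 2 1) (Pi.single 2 1)) 0,
    by simpa [jac, prd_apply] using
      congrFun (hM.2 (Pi.single 1 1) (Pi.single 2 1) (Pi.single 3 1)) 0,
    by simpa [jac, prd_apply] using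
      congrFun (hM.2 (Pi.single 1 1) (Pi.single 4 1) (Pi.single 2 1)) 0⟩

theorem classified_L5_add_cen_of_a₁₅_eq_one_of_a₂₃_eq_zero {c : ℂ} :
    Classified IsListed (prd 1 2 3 + prd 1 3 5 + prd 2 4 5 + cen 0 0 0 1 0 0 0 c 0 0) := by
  rcases ne_or_eq c 1 with h | rfl
  · exact (IsListed.M12 (-c) (by simpa using h)).classified (.of_basis ![![-1, 0, 0, 0, 0, 0],
      ![0, 0, 1, 0, 0, 0], ![0, 1, 0, 0, 0, 0], ![0, 0, 0, -1, 0, 0], ![0, 0, 0, 0, -1, 0],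
      ![0, 0, 0, 0, 0, -1]])
  · exact IsListed.L13.classified (.of_basis ![![1, 0, 0, 0, 0, 0],
      ![0, 1, 0, 0, 0, 0], ![0, 0, 1, 0, 0, 0], ![0, 0, 0, 1, 0, 0], ![0, 0, 0, 0, 1, 0],
      ![0, 0, 0, 0, 0, 1]])

theorem classified_L5_add_cen_of_a₁₅_eq_one {b c : ℂ} :
    Classified IsListed (prd 1 2 3 + prd 1 3 5 + prd 2 4 5 + cen 0 0 0 1 b 0 0 c 0 0) := by
  rcases ne_or_eq c 0 with h | rfl
  · exact Classified.of_iso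
      (ν := prd 1 2 3 + prd 1 3 5 + prd 2 4 5 + cen 0 0 0 1 0 0 0 c 0 0)
      classified_L5_add_cen_of_a₁₅_eq_one_of_a₂₃_eq_zero
      (.of_basis ![![1, 0, 0, 0, 0, 0], ![0, 1, 0, 0, 0, 0], ![0, 0, 1, 0, b / c, 0],
        ![0, 0, 0, 1, 0, 0], ![0, 0, 0, 0, 1, 0], ![0, 0, 0, 0, 0, 1]])
  rcases ne_or_eq b 0 with h | rfl
  · exact IsListed.M13.classified (.of_basis ![![-b ^ 4, 0, 0, 0, 0, 0],
      ![0, 0, b, 0, 0, 0], ![0, b, 0, 0, 0, 0], ![0, 0, 0, -b ^ 2, 0, 0],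
      ![0, 0, 0, 0, -b ^ 2, 0], ![0, 0, 0, 0, 0, -b ^ 3]])
  · exact classified_L5_add_cen_of_a₁₅_eq_one_of_a₂₃_eq_zero

theorem classified_L5_add_cen_of_a₁₅_ne_zero (h : a₁₅ ≠ 0) : Classified IsListed
    (prd 1 2 3 + prd 1 3 5 + prd 2 4 5 + cen 0 a₁₃ a₁₄ a₁₅ a₂₃ 0 0 a₃₄ 0 0) := by
  obtain ⟨p₁₃, rfl⟩ : ∃ p, a₁₃ = 2 * p * a₁₅ := ⟨a₁₃ / (2 * a₁₅), by field_simp⟩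
  obtain ⟨p₁₄, rfl⟩ := mul_right_surjective₀ h a₁₄
  obtain ⟨p₂₃, rfl⟩ := mul_right_surjective₀ h a₂₃
  obtain ⟨p₃₄, rfl⟩ := mul_right_surjective₀ h a₃₄
  exact Classified.of_iso
    (ν := prd 1 2 3 + prd 1 3 5 + prd 2 4 5 + cen 0 0 0 1 p₂₃ 0 0 p₃₄ 0 0)
    classified_L5_add_cen_of_a₁₅_eq_one
    (.of_basis ![![a₁₅, 0, 0, 0, 0, 0], ![0, 1, 0, 0, p₁₃, -p₁₃ * p₁₄],
      ![0, 0, 1, -p₁₃, 0, 0],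
      ![a₁₅ * (p₃₄ * p₁₃ ^ 2 - 2 * p₁₃ ^ 2), 0, 0, 1, 0, -2 * p₁₃], ![0, 0, 0, 0, 1, -p₁₄],
      ![-a₁₅ * p₁₃ * p₃₄, 0, 0, 0, 0, 1]])

theorem classified_L5_add_cen_of_central_e₅ :
    Classified IsListed (prd 1 2 3 + prd 1 3 5 + prd 2 4 5 + cen 0 a₁₃ a₁₄ 0 a₂₃ 0 0 a₃₄ 0 0) := by
  rcases ne_or_eq a₃₄ 0 with h | rfl
  · obtain ⟨p₁₃, rfl⟩ := mul_right_surjective₀ h a₁₃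
    obtain ⟨p₁₄, rfl⟩ := mul_right_surjective₀ h a₁₄
    obtain ⟨p₂₃, rfl⟩ := mul_right_surjective₀ h a₂₃
    exact IsListed.M4.classified (.of_basis ![![a₃₄ * p₁₃, 0, 0, 0, 0, 1],
      ![0, 1, 0, -p₁₄, 0, 0], ![0, 0, 1, p₁₃, p₂₃, 0],
      ![a₃₄ * (p₁₃ ^ 2 + p₁₄ * p₂₃), 0, 0, 1, 0, p₁₃], ![0, 0, 0, 0, 1, 0],
      ![a₃₄, 0, 0, 0, 0, 0]])
  rcases ne_or_eq a₂₃ 0 with h | rfl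
  · obtain ⟨p₁₃, rfl⟩ := mul_right_surjective₀ h a₁₃
    obtain ⟨c, hc⟩ : ∃ c, a₂₃ * (c * c) + p₁₃ * a₂₃ * c + -a₁₄ = 0 := by
      obtain ⟨r, hr⟩ := IsAlgClosed.exists_pow_nat_eq
        (discrim a₂₃ (p₁₃ * a₂₃) (-a₁₄)) (n := 2) (by norm_num)
      exact exists_quadratic_eq_zero h ⟨r, by rw [← hr, sq]⟩
    obtain rfl : a₁₄ = a₂₃ * (c * c) + p₁₃ * a₂₃ * c := by linear_combination -hc
    exact Classified.of_iso
      (ν := prd 1 2 3 + prd 1 3 4 + cen 0 0 0 1 (-1) 0 (-2 * c - p₁₃) 0 0 0)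
      classified_L3_add_cen
      (.of_basis ![![-c * a₂₃, 0, 0, 0, 0, 1], ![0, 0, 1, 0, 0, 0],
        ![0, 1, -(c + p₁₃), 0, 0, 0], ![0, 0, 0, -1, 0, 0], ![-a₂₃, 0, 0, 0, 0, 0],
        ![0, 0, 0, -c, 1, 0]])
  rcases ne_or_eq a₁₃ 0 with h | rfl
  · exact Classified.of_iso
      (ν := prd 1 2 3 + prd 1 3 4 + cen 0 0 0 (-a₁₄) 0 0 a₁₃ 0 0 0) classified_L3_add_cen
      (.of_basis ![![0, 0, 0, 0, 0, 1], ![0, 1, 0, 0, 0, 0], ![0, 0, 1, 0, 0, 0],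
        ![0, 0, 0, 1, 0, 0], ![a₁₃, 0, 0, 0, 0, 1], ![0, 0, 0, -a₁₄, a₁₃, 0]])
  rcases ne_or_eq a₁₄ 0 with h | rfl
  · exact IsListed.L23.classified (.of_basis ![![a₁₄, 0, 0, 0, 0, 0],
      ![0, 1, 0, 0, 0, 0], ![0, 0, 1, 0, 0, 0], ![0, 0, 0, 1, 0, 0],
      ![0, 0, 0, 0, 1, 0], ![0, 0, 0, 0, 0, 1]])
  intro _ hZ
  simpa using hZ.coord_eq_zero ![1, 0, 0, 0, 0, 0] 0

theorem classified_L5_add_cen : Classified IsListed (prd 1 2 3 + prd 1 3 5 + prd 2 4 5 +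
    cen a₁₂ a₁₃ a₁₄ a₁₅ a₂₃ a₂₄ a₂₅ a₃₄ a₃₅ a₄₅) := by
  intro hM
  obtain ⟨rfl, rfl, rfl⟩ := coeffs_eq_zero_of_isMalcev_L5_add_cen hM
  suffices normalized : Classified IsListed (prd 1 2 3 + prd 1 3 5 + prd 2 4 5 +
      cen 0 (a₁₃ - a₂₄) a₁₄ a₁₅ a₂₃ 0 0 a₃₄ 0 0) from
    normalized.of_iso (.of_basis ![![1, 0, 0, 0, 0, 0], ![0, 1, 0, 0, 0, 0], ![0, 0, 1, 0, 0, 0],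
      ![a₁₂, 0, 0, 1, 0, 0], ![0, 0, 0, 0, 1, 0], ![a₂₄, 0, 0, 0, 0, 1]]) hM
  rcases ne_or_eq a₁₅ 0 with h | rfl
  · exact classified_L5_add_cen_of_a₁₅_ne_zero h
  · exact classified_L5_add_cen_of_central_e₅

theorem coeffs_eq_zero_of_isMalcev_M1_add_cen
    (hM : IsMalcev (prd 1 2 3 + prd 3 4 5 + cen a₁₂ a₁₃ a₁₄ a₁₅ a₂₃ a₂₄ a₂₅ a₃₄ a₃₅ a₄₅)) :
    a₁₅ = 0 ∧ a₂₅ = 0 ∧ a₃₅ = 0 ∧ a₄₅ = 0 := by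
  have h₁ := congrFun (hM.2 (Pi.single 1 1) (Pi.single 2 1) (Pi.single 4 1)) 0
  have h₂ := congrFun (hM.2 (Pi.single 2 1) (Pi.single 1 1) (Pi.single 4 1)) 0
  have h₃ := congrFun (hM.2 (Pi.single 1 1 + Pi.single 3 1) (Pi.single 4 1) (Pi.single 2 1)) 0
  have h₄ := congrFun (hM.2 (Pi.single 4 1) (Pi.single 1 1) (Pi.single 2 1)) 0
  simp only [jac, LinearMap.add_apply, Pi.add_apply, cen_apply, prd_apply, Pi.single_apply,
    Fin.isValue, Fin.reduceEq, reduceIte, mul_zero, mul_one, mul_neg, sub_zero, zero_sub,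
    sub_self, add_zero, zero_add] at h₁ h₂ h₃ h₄
  exact ⟨by linear_combination h₁, by linear_combination -h₂, by linear_combination -h₃,
    by linear_combination h₄⟩

theorem classified_M1_add_cen_of_a₁₃_ne_zero (h : a₁₃ ≠ 0) :
    Classified IsListed (prd 1 2 3 + prd 3 4 5 + cen 0 a₁₃ a₁₄ 0 a₂₃ a₂₄ 0 0 0 0) := by
  obtain ⟨p₁₄, rfl⟩ := mul_right_surjective₀ h a₁₄
  obtain ⟨p₂₃, rfl⟩ := mul_right_surjective₀ h a₂₃
  obtain ⟨d, rfl⟩ : ∃ d, a₂₄ = a₁₃ * (d + p₂₃ * p₁₄) := by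
    obtain ⟨p₂₄, rfl⟩ := mul_right_surjective₀ h a₂₄
    exact ⟨p₂₄ - p₂₃ * p₁₄, by ring⟩
  rcases ne_or_eq d 0 with h' | rfl
  · exact IsListed.M4.classified (.of_basis ![![a₁₃, 0, 0, 0, 0, 0], ![0, 1, 0, 0, 0, 0],
      ![0, -p₂₃, 1, 0, 0, 0], ![0, 0, 0, 1, 0, 0], ![0, 0, 0, -p₁₄ / d, 1 / d, 0],
      ![0, 0, 0, 0, 0, 1 / d]])
  · exact IsListed.M2.classified (.of_basis ![![a₁₃, 0, 0, 0, 0, 0], ![0, 1, 0, 0, 0, 0],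
      ![0, -p₂₃, 1, 0, 0, 0], ![0, 0, 0, 1, 0, 0], ![0, 0, 0, -p₁₄, 1, 0],
      ![0, 0, 0, 0, 0, 1]])

theorem classified_M1_add_cen_of_central_e₅ :
    Classified IsListed (prd 1 2 3 + prd 3 4 5 + cen 0 a₁₃ a₁₄ 0 a₂₃ a₂₄ 0 0 0 0) := by
  rcases ne_or_eq a₁₃ 0 with h | rfl
  · exact classified_M1_add_cen_of_a₁₃_ne_zero h
  rcases ne_or_eq a₂₃ 0 with h | rfl
  · exact Classified.of_iso
      (ν := prd 1 2 3 + prd 3 4 5 + cen 0 (-a₂₃) a₂₄ 0 0 a₁₄ 0 0 0 0)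
      (classified_M1_add_cen_of_a₁₃_ne_zero (neg_ne_zero.2 h))
      (.of_basis ![![1, 0, 0, 0, 0, 0], ![0, 0, 1, 0, 0, 0], ![0, 1, 0, 0, 0, 0],
        ![0, 0, 0, -1, 0, 0], ![0, 0, 0, 0, 1, 0], ![0, 0, 0, 0, 0, -1]])
  rcases ne_or_eq a₁₄ 0 with h | rfl
  · exact IsListed.M3.classified (.of_basis ![![a₁₄, 0, 0, 0, 0, 0], ![0, 1, 0, 0, 0, 0],
      ![0, -a₂₄ / a₁₄, 1, 0, 0, 0], ![0, 0, 0, 1, 0, 0], ![0, 0, 0, 0, 1, 0],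
      ![0, 0, 0, 0, 0, 1]])
  rcases ne_or_eq a₂₄ 0 with h | rfl
  · exact IsListed.M3.classified (.of_basis ![![a₂₄, 0, 0, 0, 0, 0], ![0, 0, 1, 0, 0, 0],
      ![0, 1, 0, 0, 0, 0], ![0, 0, 0, -1, 0, 0], ![0, 0, 0, 0, 1, 0],
      ![0, 0, 0, 0, 0, -1]])
  intro _ hZ
  simpa using hZ.coord_eq_zero ![1, 0, 0, 0, 0, 0] 0

theorem classified_M1_add_cen :
    Classified IsListed (prd 1 2 3 + prd 3 4 5 +
      cen a₁₂ a₁₃ a₁₄ a₁₅ a₂₃ a₂₄ a₂₅ a₃₄ a₃₅ a₄₅) := by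
  intro hM
  obtain ⟨rfl, rfl, rfl, rfl⟩ := coeffs_eq_zero_of_isMalcev_M1_add_cen hM
  exact Classified.of_iso
    (ν := prd 1 2 3 + prd 3 4 5 + cen 0 a₁₃ a₁₄ 0 a₂₃ a₂₄ 0 0 0 0)
    classified_M1_add_cen_of_central_e₅
    (.of_basis ![![1, 0, 0, 0, 0, 0], ![0, 1, 0, 0, 0, 0], ![0, 0, 1, 0, 0, 0],
      ![a₁₂, 0, 0, 1, 0, 0], ![0, 0, 0, 0, 1, 0], ![a₃₄, 0, 0, 0, 0, 1]]) hM

theorem classified_L4_add_cen_of_a₁₂_ne_zero_of_pfaffian_eq_zero (h : a₁₂ ≠ 0)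
    (hp : a₁₂ * a₃₄ - a₁₃ * a₂₄ + a₁₄ * a₂₃ = 0) :
    Classified IsListed (prd 1 2 5 + prd 3 4 5 +
      cen a₁₂ a₁₃ a₁₄ 0 a₂₃ a₂₄ 0 a₃₄ 0 0) :=
  Classified.of_iso
    (ν := prd 1 2 3 + cen 0 0 (-a₁₃) (-a₁₄) 0 (-a₂₃) (-a₂₄) 0 0
      (a₁₂ ^ 2 + a₁₃ * a₂₄ - a₂₃ * a₁₄))
    classified_L2_add_cen
    (.of_basis ![![0, 0, 0, 0, 0, 1], ![0, 1, 0, 0, 0, 0], ![0, 0, 1, 0, 0, 0],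
      ![a₁₂, 0, 0, 0, 0, 1], ![0, a₂₃, -a₁₃, a₁₂, 0, 0], ![0, a₂₄, -a₁₄, 0, a₁₂, 0]])

theorem classified_L4_add_cen_of_a₁₃_ne_zero_of_pfaffian_eq_zero (h : a₁₃ ≠ 0)
    (hp : a₁₄ * a₂₃ = a₁₃ * a₂₄) :
    Classified IsListed (prd 1 2 5 + prd 3 4 5 + cen 0 a₁₃ a₁₄ 0 a₂₃ a₂₄ 0 0 0 0) :=
  Classified.of_iso (ν := prd 1 2 3 + cen 0 0 a₁₃ 0 0 0 a₁₃ 0 0 0)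
    classified_L2_add_cen
    (.of_basis ![![0, 0, 0, 0, 0, 1], ![0, 1, 0, 0, 0, 0], ![0, 0, 0, 1, 0, 0],
      ![a₁₃, 0, 0, 0, 0, 0], ![0, -a₂₃, a₁₃, 0, 0, 0], ![0, 0, 0, -a₁₄, a₁₃, 0]])

theorem classified_L4_add_cen_of_block_of_pfaffian_eq_zero (hp : a₁₄ * a₂₃ = a₁₃ * a₂₄) :
    Classified IsListed (prd 1 2 5 + prd 3 4 5 + cen 0 a₁₃ a₁₄ 0 a₂₃ a₂₄ 0 0 0 0) := by
  rcases ne_or_eq a₁₃ 0 with h | rfl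
  · exact classified_L4_add_cen_of_a₁₃_ne_zero_of_pfaffian_eq_zero h hp
  rcases ne_or_eq a₁₄ 0 with h | rfl
  · exact Classified.of_iso
      (ν := prd 1 2 5 + prd 3 4 5 + cen 0 a₁₄ 0 0 a₂₄ (-a₂₃) 0 0 0 0)
      (classified_L4_add_cen_of_a₁₃_ne_zero_of_pfaffian_eq_zero h (by linear_combination hp))
      (.of_basis ![![1, 0, 0, 0, 0, 0], ![0, 1, 0, 0, 0, 0], ![0, 0, 1, 0, 0, 0],
        ![0, 0, 0, 0, 1, 0], ![0, 0, 0, -1, 0, 0], ![0, 0, 0, 0, 0, 1]])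
  rcases ne_or_eq a₂₃ 0 with h | rfl
  · exact Classified.of_iso
      (ν := prd 1 2 5 + prd 3 4 5 + cen 0 a₂₃ a₂₄ 0 0 0 0 0 0 0)
      (classified_L4_add_cen_of_a₁₃_ne_zero_of_pfaffian_eq_zero h (by ring))
      (.of_basis ![![1, 0, 0, 0, 0, 0], ![0, 0, 1, 0, 0, 0], ![0, -1, 0, 0, 0, 0],
        ![0, 0, 0, 1, 0, 0], ![0, 0, 0, 0, 1, 0], ![0, 0, 0, 0, 0, 1]])
  rcases ne_or_eq a₂₄ 0 with h | rfl
  · exact Classified.of_iso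
      (ν := prd 1 2 5 + prd 3 4 5 + cen 0 a₂₄ 0 0 0 0 0 0 0 0)
      (classified_L4_add_cen_of_a₁₃_ne_zero_of_pfaffian_eq_zero h (by ring))
      (.of_basis ![![1, 0, 0, 0, 0, 0], ![0, 0, 1, 0, 0, 0], ![0, -1, 0, 0, 0, 0],
        ![0, 0, 0, 0, 1, 0], ![0, 0, 0, -1, 0, 0], ![0, 0, 0, 0, 0, 1]])
  intro _ hZ
  simpa using hZ.coord_eq_zero ![1, 0, 0, 0, 0, 0] 0

theorem classified_L4_add_cen_of_pfaffian_eq_zero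
    (hp : a₁₂ * a₃₄ - a₁₃ * a₂₄ + a₁₄ * a₂₃ = 0) :
    Classified IsListed (prd 1 2 5 + prd 3 4 5 +
      cen a₁₂ a₁₃ a₁₄ 0 a₂₃ a₂₄ 0 a₃₄ 0 0) := by
  rcases ne_or_eq a₁₂ 0 with h | rfl
  · exact classified_L4_add_cen_of_a₁₂_ne_zero_of_pfaffian_eq_zero h hp
  rcases ne_or_eq a₃₄ 0 with h | rfl
  · exact Classified.of_iso
      (ν := prd 1 2 5 + prd 3 4 5 + cen a₃₄ (-a₁₃) (-a₂₃) 0 (-a₁₄) (-a₂₄) 0 0 0 0)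
      (classified_L4_add_cen_of_a₁₂_ne_zero_of_pfaffian_eq_zero h (by linear_combination hp))
      (.of_basis ![![1, 0, 0, 0, 0, 0], ![0, 0, 0, 1, 0, 0], ![0, 0, 0, 0, 1, 0],
        ![0, 1, 0, 0, 0, 0], ![0, 0, 1, 0, 0, 0], ![0, 0, 0, 0, 0, 1]])
  · exact classified_L4_add_cen_of_block_of_pfaffian_eq_zero (by linear_combination hp)

/-- Adding a multiple of the central vector to `e₅` adds that multiple to both `a₁₂` and `a₃₄`;
over an algebraically closed field this makes the Pfaffian vanish. -/
theorem classified_L4_add_cen_of_central_e₅ :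
    Classified IsListed (prd 1 2 5 + prd 3 4 5 + cen 0 a₁₃ a₁₄ 0 a₂₃ a₂₄ 0 a₃₄ 0 0) := by
  obtain ⟨s, hs⟩ : ∃ s, 1 * (s * s) + a₃₄ * s + (a₁₄ * a₂₃ - a₁₃ * a₂₄) = 0 := by
    obtain ⟨r, hr⟩ := IsAlgClosed.exists_pow_nat_eq
      (discrim 1 a₃₄ (a₁₄ * a₂₃ - a₁₃ * a₂₄)) (n := 2) (by norm_num)
    exact exists_quadratic_eq_zero one_ne_zero ⟨r, by rw [← hr, sq]⟩
  exact Classified.of_iso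
    (ν := prd 1 2 5 + prd 3 4 5 + cen s a₁₃ a₁₄ 0 a₂₃ a₂₄ 0 (s + a₃₄) 0 0)
    (classified_L4_add_cen_of_pfaffian_eq_zero (by linear_combination hs))
    (.of_basis ![![1, 0, 0, 0, 0, 0], ![0, 1, 0, 0, 0, 0], ![0, 0, 1, 0, 0, 0],
      ![0, 0, 0, 1, 0, 0], ![0, 0, 0, 0, 1, 0], ![-s, 0, 0, 0, 0, 1]])

theorem classified_L4_add_cen_of_a₁₅_eq_one :
    Classified IsListed (prd 1 2 5 + prd 3 4 5 + cen 0 0 0 1 a₂₃ a₂₄ 0 0 0 0) := by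
  rcases ne_or_eq a₂₃ 0 with h | rfl
  · exact IsListed.M11.classified (.of_basis ![![1, 0, 0, 0, 0, 0], ![0, 1, 0, 0, 0, 0],
      ![0, 0, 1, 0, 0, 0], ![0, 0, 0, 1 / a₂₃, 0, 0], ![0, 0, 0, -a₂₄, a₂₃, 0],
      ![0, 0, 0, 0, 0, 1]])
  rcases ne_or_eq a₂₄ 0 with h | rfl
  · exact IsListed.M11.classified (.of_basis ![![1, 0, 0, 0, 0, 0], ![0, 1, 0, 0, 0, 0],
      ![0, 0, 1, 0, 0, 0], ![0, 0, 0, 0, 1 / a₂₄, 0], ![0, 0, 0, -a₂₄, 0, 0],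
      ![0, 0, 0, 0, 0, 1]])
  exact IsListed.M10.classified (.of_basis ![![1, 0, 0, 0, 0, 0], ![0, 1, 0, 0, 0, 0],
    ![0, 0, 1, 0, 0, 0], ![0, 0, 0, 1, 0, 0], ![0, 0, 0, 0, 1, 0], ![0, 0, 0, 0, 0, 1]])

theorem classified_L4_add_cen_of_a₁₅_ne_zero (h : a₁₅ ≠ 0) :
    Classified IsListed (prd 1 2 5 + prd 3 4 5 +
      cen 0 a₁₃ a₁₄ a₁₅ a₂₃ a₂₄ a₂₅ a₃₄ a₃₅ a₄₅) := by
  obtain ⟨p₁₃, rfl⟩ := mul_right_surjective₀ h a₁₃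
  obtain ⟨p₁₄, rfl⟩ := mul_right_surjective₀ h a₁₄
  obtain ⟨p₂₃, rfl⟩ := mul_right_surjective₀ h a₂₃
  obtain ⟨p₂₄, rfl⟩ := mul_right_surjective₀ h a₂₄
  obtain ⟨p₂₅, rfl⟩ := mul_right_surjective₀ h a₂₅
  obtain ⟨p₃₄, rfl⟩ := mul_right_surjective₀ h a₃₄
  obtain ⟨p₃₅, rfl⟩ := mul_right_surjective₀ h a₃₅
  obtain ⟨p₄₅, rfl⟩ := mul_right_surjective₀ h a₄₅
  exact Classified.of_iso
    (ν := prd 1 2 5 + prd 3 4 5 + cen 0 0 0 1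
      (p₂₃ - p₂₅ * p₁₃ - p₃₅ * p₃₄ - p₃₅ * (p₄₅ * p₁₃ - p₃₅ * p₁₄))
      (p₂₄ - p₂₅ * p₁₄ - p₄₅ * p₃₄ - p₄₅ * (p₄₅ * p₁₃ - p₃₅ * p₁₄)) 0 0 0 0)
    classified_L4_add_cen_of_a₁₅_eq_one
    (.of_basis ![![a₁₅, 0, 0, 0, 0, 0], ![0, 1, 0, 0, 0, 0],
      ![0, -p₂₅, 1, -p₄₅, p₃₅, p₃₄ + 2 * p₁₃ * p₄₅ - 2 * p₁₄ * p₃₅],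
      ![0, -p₃₅, 0, 1, 0, -p₁₃], ![0, -p₄₅, 0, 0, 1, -p₁₄],
      ![a₁₅ * (p₃₄ + p₁₃ * p₄₅ - p₁₄ * p₃₅), 0, 0, 0, 0, 1]])

theorem classified_L4_add_cen_of_a₁₂_eq_zero :
    Classified IsListed (prd 1 2 5 + prd 3 4 5 +
      cen 0 a₁₃ a₁₄ a₁₅ a₂₃ a₂₄ a₂₅ a₃₄ a₃₅ a₄₅) := by
  rcases ne_or_eq a₁₅ 0 with h | rfl
  · exact classified_L4_add_cen_of_a₁₅_ne_zero h
  rcases ne_or_eq a₂₅ 0 with h | rfl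
  · exact Classified.of_iso
      (ν := prd 1 2 5 + prd 3 4 5 + cen 0 a₂₃ a₂₄ a₂₅ (-a₁₃) (-a₁₄) 0 a₃₄ a₃₅ a₄₅)
      (classified_L4_add_cen_of_a₁₅_ne_zero h)
      (.of_basis ![![1, 0, 0, 0, 0, 0], ![0, 0, 1, 0, 0, 0], ![0, -1, 0, 0, 0, 0],
        ![0, 0, 0, 1, 0, 0], ![0, 0, 0, 0, 1, 0], ![0, 0, 0, 0, 0, 1]])
  rcases ne_or_eq a₃₅ 0 with h | rfl
  · exact Classified.of_iso
      (ν := prd 1 2 5 + prd 3 4 5 +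
        cen 0 (-a₁₃) (-a₂₃) a₃₅ (-a₁₄) (-a₂₄) a₄₅ (-a₃₄) 0 0)
      (classified_L4_add_cen_of_a₁₅_ne_zero h)
      (.of_basis ![![1, 0, 0, 0, 0, 0], ![0, 0, 0, 1, 0, 0], ![0, 0, 0, 0, 1, 0],
        ![0, 1, 0, 0, 0, 0], ![0, 0, 1, 0, 0, 0], ![a₃₄, 0, 0, 0, 0, 1]])
  rcases ne_or_eq a₄₅ 0 with h | rfl
  · exact Classified.of_iso
      (ν := prd 1 2 5 + prd 3 4 5 + cen 0 (-a₁₄) (-a₂₄) a₄₅ a₁₃ a₂₃ 0 (-a₃₄) 0 0)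
      (classified_L4_add_cen_of_a₁₅_ne_zero h)
      (.of_basis ![![1, 0, 0, 0, 0, 0], ![0, 0, 0, 0, 1, 0], ![0, 0, 0, -1, 0, 0],
        ![0, 1, 0, 0, 0, 0], ![0, 0, 1, 0, 0, 0], ![a₃₄, 0, 0, 0, 0, 1]])
  exact classified_L4_add_cen_of_central_e₅

theorem classified_L4_add_cen :
    Classified IsListed (prd 1 2 5 + prd 3 4 5 +
      cen a₁₂ a₁₃ a₁₄ a₁₅ a₂₃ a₂₄ a₂₅ a₃₄ a₃₅ a₄₅) :=
  Classified.of_iso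
    (ν := prd 1 2 5 + prd 3 4 5 + cen 0 a₁₃ a₁₄ a₁₅ a₂₃ a₂₄ a₂₅ (a₃₄ - a₁₂) a₃₅ a₄₅)
    classified_L4_add_cen_of_a₁₂_eq_zero
    (.of_basis ![![1, 0, 0, 0, 0, 0], ![0, 1, 0, 0, 0, 0], ![0, 0, 1, 0, 0, 0],
      ![0, 0, 0, 1, 0, 0], ![0, 0, 0, 0, 1, 0], ![a₁₂, 0, 0, 0, 0, 1]])

theorem coeff_relations_of_isMalcev_L9_add_cen
    (hM : IsMalcev (prd 1 2 3 + prd 1 3 4 + prd 2 3 5 +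
      cen a₁₂ a₁₃ a₁₄ a₁₅ a₂₃ a₂₄ a₂₅ a₃₄ a₃₅ a₄₅)) :
    a₂₄ = a₁₅ ∧ a₃₄ = 0 ∧ a₃₅ = 0 ∧ a₄₅ = 0 := by
  have h₁ := congrFun (hM.2 (Pi.single 1 1) (Pi.single 2 1) (Pi.single 2 1)) 0
  have h₂ := congrFun (hM.2 (Pi.single 1 1) (Pi.single 2 1) (Pi.single 3 1)) 0
  have h₃ := congrFun (hM.2 (Pi.single 2 1) (Pi.single 1 1) (Pi.single 3 1)) 0
  have h₄ := congrFun (hM.2 (Pi.single 1 1) (Pi.single 5 1) (Pi.single 2 1)) 0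
  simp only [jac, LinearMap.add_apply, Pi.add_apply, cen_apply, prd_apply, Pi.single_apply,
    Fin.isValue, Fin.reduceEq, reduceIte, mul_zero, mul_one, mul_neg, sub_zero, zero_sub,
    sub_self, add_zero, zero_add] at h₁ h₂ h₃ h₄
  exact ⟨by linear_combination h₁, by linear_combination h₂, by linear_combination -h₃,
    by linear_combination -h₄⟩

theorem classified_L9_add_cen_of_a₁₄_ne_zero (h : a₁₄ ≠ 0) :
    Classified IsListed (prd 1 2 3 + prd 1 3 4 + prd 2 3 5 +
      cen 0 0 a₁₄ a₁₅ 0 a₁₅ a₂₅ 0 0 0) := by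
  obtain ⟨q, rfl⟩ := mul_right_surjective₀ h a₁₅
  obtain ⟨r, rfl⟩ : ∃ r, a₂₅ = a₁₄ * (r ^ 2 + q ^ 2) := by
    obtain ⟨r, hr⟩ := IsAlgClosed.exists_pow_nat_eq (a₂₅ / a₁₄ - q ^ 2) (n := 2) (by norm_num)
    exact ⟨r, by rw [hr]; field_simp; ring⟩
  rcases ne_or_eq r 0 with h' | rfl
  · exact IsListed.L21b.classified (.of_basis ![![a₁₄ * r ^ 3, 0, 0, 0, 0, 0],
      ![0, r, 0, 0, 0, 0], ![0, -q, 1, 0, 0, 0], ![0, 0, 0, r, 0, 0], ![0, 0, 0, 0, r ^ 2, 0],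
      ![0, 0, 0, 0, -q * r, r]])
  · exact IsListed.L21a.classified (.of_basis ![![a₁₄, 0, 0, 0, 0, 0],
      ![0, 1, 0, 0, 0, 0], ![0, -q, 1, 0, 0, 0], ![0, 0, 0, 1, 0, 0], ![0, 0, 0, 0, 1, 0],
      ![0, 0, 0, 0, -q, 1]])

/-- The values of `cen` on `{e₁, e₂} × {e₄, e₅}` form a symmetric matrix that changes by congruence
under a change of `e₁, e₂`; unless it vanishes, its first entry can be made nonzero. -/
theorem classified_L9_add_cen_of_symm_block :
    Classified IsListed (prd 1 2 3 + prd 1 3 4 + prd 2 3 5 +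
      cen 0 0 a₁₄ a₁₅ 0 a₁₅ a₂₅ 0 0 0) := by
  rcases ne_or_eq a₁₄ 0 with h | rfl
  · exact classified_L9_add_cen_of_a₁₄_ne_zero h
  rcases ne_or_eq a₂₅ 0 with h | rfl
  · exact Classified.of_iso
      (ν := prd 1 2 3 + prd 1 3 4 + prd 2 3 5 + cen 0 0 (-a₂₅) (-a₁₅) 0 (-a₁₅) 0 0 0 0)
      (classified_L9_add_cen_of_a₁₄_ne_zero (neg_ne_zero.2 h))
      (.of_basis ![![1, 0, 0, 0, 0, 0], ![0, 0, 1, 0, 0, 0], ![0, 1, 0, 0, 0, 0],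
        ![0, 0, 0, -1, 0, 0], ![0, 0, 0, 0, 0, -1], ![0, 0, 0, 0, -1, 0]])
  rcases ne_or_eq a₁₅ 0 with h | rfl
  · exact Classified.of_iso
      (ν := prd 1 2 3 + prd 1 3 4 + prd 2 3 5 + cen 0 0 (2 * a₁₅) a₁₅ 0 a₁₅ 0 0 0 0)
      (classified_L9_add_cen_of_a₁₄_ne_zero (mul_ne_zero two_ne_zero h))
      (.of_basis ![![1, 0, 0, 0, 0, 0], ![0, 1, 1, 0, 0, 0], ![0, 0, 1, 0, 0, 0],
        ![0, 0, 0, 1, 0, 0], ![0, 0, 0, 0, 1, 1], ![0, 0, 0, 0, 0, 1]])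
  intro _ hZ
  simpa using hZ.coord_eq_zero ![1, 0, 0, 0, 0, 0] 0

theorem classified_L9_add_cen :
    Classified IsListed (prd 1 2 3 + prd 1 3 4 + prd 2 3 5 +
      cen a₁₂ a₁₃ a₁₄ a₁₅ a₂₃ a₂₄ a₂₅ a₃₄ a₃₅ a₄₅) := by
  intro hM
  obtain ⟨rfl, rfl, rfl, rfl⟩ := coeff_relations_of_isMalcev_L9_add_cen hM
  exact Classified.of_iso
    (ν := prd 1 2 3 + prd 1 3 4 + prd 2 3 5 + cen 0 0 a₁₄ a₂₄ 0 a₂₄ a₂₅ 0 0 0)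
    classified_L9_add_cen_of_symm_block
    (.of_basis ![![1, 0, 0, 0, 0, 0], ![0, 1, 0, 0, 0, 0], ![0, 0, 1, 0, 0, 0],
      ![a₁₂, 0, 0, 1, 0, 0], ![a₁₃, 0, 0, 0, 1, 0], ![a₂₃, 0, 0, 0, 0, 1]]) hM

theorem coeff_relations_of_isMalcev_L7_add_cen
    (hM : IsMalcev (prd 1 2 3 + prd 1 3 4 + prd 1 4 5 +
      cen a₁₂ a₁₃ a₁₄ a₁₅ a₂₃ a₂₄ a₂₅ a₃₄ a₃₅ a₄₅)) :
    a₂₄ = 0 ∧ a₃₄ = -a₂₅ ∧ a₃₅ = 0 ∧ a₄₅ = 0 := by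
  have h₁ := congrFun (hM.2 (Pi.single 1 1) (Pi.single 2 1) (Pi.single 2 1)) 0
  have h₂ := congrFun (hM.2 (Pi.single 1 1) (Pi.single 2 1) (Pi.single 3 1)) 0
  have h₃ := congrFun (hM.2 (Pi.single 1 1) (Pi.single 2 1) (Pi.single 4 1)) 0
  have h₄ := congrFun (hM.2 (Pi.single 1 1) (Pi.single 3 1) (Pi.single 4 1)) 0
  simp only [jac, LinearMap.add_apply, Pi.add_apply, cen_apply, prd_apply, Pi.single_apply,
    Fin.isValue, Fin.reduceEq, reduceIte, mul_zero, mul_one, mul_neg, sub_zero, zero_sub,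
    sub_self, add_zero, zero_add] at h₁ h₂ h₃ h₄
  exact ⟨by linear_combination h₁, by linear_combination h₂, by linear_combination h₃,
    by linear_combination h₄⟩

theorem classified_L7_add_cen_of_a₂₅_ne_zero (h : a₂₅ ≠ 0) :
    Classified IsListed (prd 1 2 3 + prd 1 3 4 + prd 1 4 5 +
      cen 0 0 0 a₁₅ a₂₃ 0 a₂₅ (-a₂₅) 0 0) := by
  obtain ⟨p₁₅, rfl⟩ := mul_right_surjective₀ h a₁₅
  obtain ⟨c, rfl⟩ : ∃ c, a₂₃ = -2 * c * a₂₅ := ⟨-a₂₃ / (2 * a₂₅), by field_simp⟩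
  exact IsListed.L16.classified (.of_basis ![![a₂₅, 0, 0, 0, 0, 0], ![0, 1, -p₁₅, 0, 0, 0],
    ![0, 0, 1, 0, c, 0], ![0, 0, 0, 1, 0, c], ![2 * a₂₅ * p₁₅ * c, 0, 0, 0, 1, 0],
    ![0, 0, 0, 0, 0, 1]])

theorem classified_L7_add_cen_of_a₂₅_eq_zero :
    Classified IsListed (prd 1 2 3 + prd 1 3 4 + prd 1 4 5 +
      cen 0 0 0 a₁₅ a₂₃ 0 0 0 0 0) := by
  rcases ne_or_eq a₁₅ 0 with h | rfl
  · rcases ne_or_eq a₂₃ 0 with h' | rfl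
    · exact IsListed.L17.classified (.of_basis ![![a₁₅ * (a₁₅ / a₂₃), 0, 0, 0, 0, 0],
        ![0, 1, 0, 0, 0, 0], ![0, 0, a₁₅ / a₂₃, 0, 0, 0], ![0, 0, 0, a₁₅ / a₂₃, 0, 0],
        ![0, 0, 0, 0, a₁₅ / a₂₃, 0], ![0, 0, 0, 0, 0, a₁₅ / a₂₃]])
    · exact IsListed.L18.classified (.of_basis ![![a₁₅, 0, 0, 0, 0, 0],
        ![0, 1, 0, 0, 0, 0], ![0, 0, 1, 0, 0, 0], ![0, 0, 0, 1, 0, 0],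
        ![0, 0, 0, 0, 1, 0], ![0, 0, 0, 0, 0, 1]])
  rcases ne_or_eq a₂₃ 0 with h | rfl
  · exact IsListed.L21a.classified (.of_basis ![![0, 0, 0, 0, 0, 1],
      ![0, 1, 0, 0, 0, 0], ![0, 0, 1, 0, 0, 0], ![0, 0, 0, 1, 0, 0],
      ![0, 0, 0, 0, 1, 0], ![a₂₃, 0, 0, 0, 0, 0]])
  intro _ hZ
  simpa using hZ.coord_eq_zero ![1, 0, 0, 0, 0, 0] 0

theorem classified_L7_add_cen :
    Classified IsListed (prd 1 2 3 + prd 1 3 4 + prd 1 4 5 +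
      cen a₁₂ a₁₃ a₁₄ a₁₅ a₂₃ a₂₄ a₂₅ a₃₄ a₃₅ a₄₅) := by
  intro hM
  obtain ⟨rfl, rfl, rfl, rfl⟩ := coeff_relations_of_isMalcev_L7_add_cen hM
  suffices normalized : Classified IsListed (prd 1 2 3 + prd 1 3 4 + prd 1 4 5 +
      cen 0 0 0 a₁₅ a₂₃ 0 a₂₅ (-a₂₅) 0 0) from
    normalized.of_iso (.of_basis ![![1, 0, 0, 0, 0, 0], ![0, 1, 0, 0, 0, 0],
      ![0, 0, 1, 0, 0, 0], ![a₁₂, 0, 0, 1, 0, 0], ![a₁₃, 0, 0, 0, 1, 0],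
      ![a₁₄, 0, 0, 0, 0, 1]]) hM
  rcases ne_or_eq a₂₅ 0 with h | rfl
  · exact classified_L7_add_cen_of_a₂₅_ne_zero h
  · rw [neg_zero]
    exact classified_L7_add_cen_of_a₂₅_eq_zero

theorem coeff_relations_of_isMalcev_L6_add_cen
    (hM : IsMalcev (prd 1 2 3 + prd 1 3 4 + prd 1 4 5 + prd 2 3 5 +
      cen a₁₂ a₁₃ a₁₄ a₁₅ a₂₃ a₂₄ a₂₅ a₃₄ a₃₅ a₄₅)) :
    a₂₄ = a₁₅ ∧ a₃₄ = -a₂₅ ∧ a₃₅ = 0 ∧ a₄₅ = 0 := by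
  have h₁ := congrFun (hM.2 (Pi.single 1 1) (Pi.single 2 1) (Pi.single 2 1)) 0
  have h₂ := congrFun (hM.2 (Pi.single 1 1) (Pi.single 2 1) (Pi.single 3 1)) 0
  have h₃ := congrFun (hM.2 (Pi.single 1 1) (Pi.single 2 1) (Pi.single 4 1)) 0
  have h₄ := congrFun (hM.2 (Pi.single 1 1) (Pi.single 3 1) (Pi.single 4 1)) 0
  simp only [jac, LinearMap.add_apply, Pi.add_apply, cen_apply, prd_apply, Pi.single_apply,
    Fin.isValue, Fin.reduceEq, reduceIte, mul_zero, mul_one, mul_neg, sub_zero, zero_sub,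
    sub_self, add_zero, zero_add] at h₁ h₂ h₃ h₄
  exact ⟨by linear_combination h₁, by linear_combination h₂, by linear_combination h₃,
    by linear_combination h₄⟩

theorem classified_L6_add_cen_of_a₂₅_ne_zero (h : a₂₅ ≠ 0) :
    Classified IsListed (prd 1 2 3 + prd 1 3 4 + prd 1 4 5 + prd 2 3 5 +
      cen 0 0 0 a₁₅ a₂₃ a₁₅ a₂₅ (-a₂₅) 0 0) := by
  obtain ⟨b, rfl⟩ := mul_right_surjective₀ h a₁₅
  obtain ⟨c, rfl⟩ : ∃ c, a₂₃ = -(2 * c + b ^ 2) * a₂₅ :=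
    ⟨-(a₂₃ / a₂₅ + b ^ 2) / 2, by field_simp; ring⟩
  exact IsListed.L14.classified (.of_basis ![![a₂₅, 0, 0, 0, 0, 0], ![0, 1, -b, 0, 0, 0],
    ![0, 0, 1, 0, c, 0], ![-a₂₅ * b ^ 2 * c, 0, 0, 1, 0, c],
    ![a₂₅ * b * (2 * c + b ^ 2), 0, 0, 0, 1, -b], ![-a₂₅ * b ^ 2, 0, 0, 0, 0, 1]])

theorem classified_L6_add_cen_of_a₂₅_eq_zero :
    Classified IsListed (prd 1 2 3 + prd 1 3 4 + prd 1 4 5 + prd 2 3 5 +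
      cen 0 0 0 a₁₅ a₂₃ a₁₅ 0 0 0 0) := by
  rcases ne_or_eq a₁₅ 0 with h | rfl
  · obtain ⟨c, rfl⟩ : ∃ c, a₂₃ = 2 * c * a₁₅ := ⟨a₂₃ / (2 * a₁₅), by field_simp⟩
    exact IsListed.L15.classified (.of_basis ![![a₁₅, 0, 0, 0, 0, 0], ![0, 1, c, 0, 0, 0],
      ![0, 0, 1, 0, 0, 0], ![0, 0, 0, 1, 0, 0], ![2 * c ^ 2 * a₁₅, 0, 0, 0, 1, c],
      ![2 * c * a₁₅, 0, 0, 0, 0, 1]])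
  rcases ne_or_eq a₂₃ 0 with h | rfl
  · exact IsListed.L21a.classified (.of_basis ![![0, 0, 0, 0, 0, 1],
      ![0, 1, 0, 0, 0, 0], ![0, 0, 1, 0, 0, 0], ![0, 0, 0, 1, 0, 0],
      ![0, 0, 0, 0, 1, 0], ![a₂₃, 0, 0, 0, 0, 1]])
  intro _ hZ
  simpa using hZ.coord_eq_zero ![1, 0, 0, 0, 0, 0] 0

theorem classified_L6_add_cen :
    Classified IsListed (prd 1 2 3 + prd 1 3 4 + prd 1 4 5 + prd 2 3 5 +
      cen a₁₂ a₁₃ a₁₄ a₁₅ a₂₃ a₂₄ a₂₅ a₃₄ a₃₅ a₄₅) := by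
  intro hM
  obtain ⟨rfl, rfl, rfl, rfl⟩ := coeff_relations_of_isMalcev_L6_add_cen hM
  suffices normalized : Classified IsListed (prd 1 2 3 + prd 1 3 4 + prd 1 4 5 + prd 2 3 5 +
      cen 0 0 0 a₂₄ (a₂₃ - a₁₄) a₂₄ a₂₅ (-a₂₅) 0 0) from
    normalized.of_iso (.of_basis ![![1, 0, 0, 0, 0, 0], ![0, 1, 0, 0, 0, 0],
      ![0, 0, 1, 0, 0, 0], ![a₁₂, 0, 0, 1, 0, 0], ![a₁₃, 0, 0, 0, 1, 0],
      ![a₁₄, 0, 0, 0, 0, 1]]) hM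
  rcases ne_or_eq a₂₅ 0 with h | rfl
  · exact classified_L6_add_cen_of_a₂₅_ne_zero h
  · rw [neg_zero]
    exact classified_L6_add_cen_of_a₂₅_eq_zero

theorem isListed_extend {B : Alg (Fin 5 → ℂ)} (hB : Listed5 B) :
    extend B 0 = 0 ∨ IsListed (extend B 0) := by
  cases hB with
  | zero => exact .inl extend_zero
  | L2 => exact .inr (by simp only [extend_pr]; exact .L2)
  | L3 => exact .inr (by simp only [extend_add, extend_pr]; exact .L3)
  | L4 => exact .inr (by simp only [extend_add, extend_pr]; exact .L4)
  | L5 => exact .inr (by simp only [extend_add, extend_pr]; exact .L5)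
  | L6 => exact .inr (by simp only [extend_add, extend_pr]; exact .L6)
  | L7 => exact .inr (by simp only [extend_add, extend_pr]; exact .L7)
  | L8 => exact .inr (by simp only [extend_add, extend_pr]; exact .L8)
  | L9 => exact .inr (by simp only [extend_add, extend_pr]; exact .L9)
  | M1 => exact .inr (by simp only [extend_add, extend_pr]; exact .M1)

theorem classified_extend {B : Alg (Fin 5 → ℂ)} (hB : Listed5 B)
    {θ : LinearMap.BilinForm ℂ (Fin 5 → ℂ)} (hθ : ∀ x y, θ x y = -θ y x) :
    Classified IsListed (extend B θ) := by
  obtain ⟨a₁₂, a₁₃, a₁₄, a₁₅, a₂₃, a₂₄, a₂₅, a₃₄, a₃₅, a₄₅, h⟩ := exists_extend_eq_six B hθ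
  cases hB with
  | zero => exact fun _ hZ => absurd hZ (not_annLeSq_extend_of_odd (by decide) hθ)
  | L2 => rw [h, extend_pr]; exact classified_L2_add_cen
  | L3 => simp only [h, extend_add, extend_pr]; exact classified_L3_add_cen
  | L4 => simp only [h, extend_add, extend_pr]; exact classified_L4_add_cen
  | L5 => simp only [h, extend_add, extend_pr]; exact classified_L5_add_cen
  | L6 => simp only [h, extend_add, extend_pr]; exact classified_L6_add_cen
  | L7 => simp only [h, extend_add, extend_pr]; exact classified_L7_add_cen
  | L8 => simp only [h, extend_add, extend_pr]; exact classified_L8_add_cen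
  | L9 => simp only [h, extend_add, extend_pr]; exact classified_L9_add_cen
  | M1 => simp only [h, extend_add, extend_pr]; exact classified_M1_add_cen

theorem isComplete_six : IsComplete.{u} 6 (fun ν => ν = 0 ∨ IsListed ν) :=
  isComplete_five.succ (fun _ => isListed_extend) fun _ hB _ hθ hM hZ => by
    obtain ⟨ν, hν, e⟩ := classified_extend hB hθ hM hZ
    exact ⟨ν, .inr hν, e⟩

end DimensionSix

section ListedAlgebras

variable {ν : Alg (Fin 6 → ℂ)}

theorem prd_mem_triangularTables {i j k : Fin 6} (hi : i - 1 < k - 1) (hj : j - 1 < k - 1) :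
    prd i j k ∈ triangularTables 6 :=
  pr_mem_triangularTables hi hj

theorem IsListed.mem_triangularTables (h : IsListed ν) : ν ∈ triangularTables 6 := by
  have add {μ μ' : Alg (Fin 6 → ℂ)} (h : μ ∈ triangularTables 6) (h' : μ' ∈ triangularTables 6) :
    μ + μ' ∈ triangularTables 6 := Submodule.add_mem _ h h'
  have sub {μ μ' : Alg (Fin 6 → ℂ)} (h : μ ∈ triangularTables 6) (h' : μ' ∈ triangularTables 6) :
    μ - μ' ∈ triangularTables 6 := by
    rw [show μ - μ' = μ + (-1 : ℂ) • μ' by module]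
    exact add h (Submodule.smul_mem _ _ h')
  cases h
  all_goals
    repeat' with_reducible first
      | refine prd_mem_triangularTables ?_ ?_
      | refine add ?_ ?_
      | refine sub ?_ ?_
      | refine Submodule.smul_mem _ _ ?_
  all_goals decide

theorem IsListed.isAnticomm (h : IsListed ν) : IsAnticomm ν :=
  isAnticomm_of_mem_triangularTables h.mem_triangularTables

theorem IsListed.isNilp (h : IsListed ν) : IsNilp ν :=
  isNilp_of_mem_triangularTables h.mem_triangularTables

theorem IsListed.ne_zero (h : IsListed ν) : ν ≠ 0 := by
  suffices ∃ i, ν (Pi.single 1 1) (Pi.single 2 1) i ≠ 0 by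
    rintro rfl
    simp at this
  cases h
  all_goals
    simp only [LinearMap.add_apply, LinearMap.sub_apply, LinearMap.smul_apply, Pi.add_apply,
      Pi.sub_apply, Pi.smul_apply, prd_apply]
    first
      | refine ⟨3, ?_⟩; simp; done
      | refine ⟨4, ?_⟩; simp; done
      | refine ⟨5, ?_⟩; simp

set_option maxHeartbeats 4000000 in
-- every multiplication table is checked entry by entry, on general vectors
theorem IsListed.isLie_or_isMetabelian (h : IsListed ν) :
    (IsLie ν ∧ ¬ IsMetabelian ν) ∨
      IsMetabelian ν ∧ (∀ x y z w, ν (jac ν x y z) w = 0) ∧ ∀ x y z w, jac ν x y (ν z w) = 0 := by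
  have hA := h.isAnticomm
  cases h
  case' L14 | L16 =>
    refine .inl ⟨⟨hA, fun x y z => ?_⟩, fun h => ?_⟩
    rotate_left
    · simpa [prd_apply] using
        congrFun (h (Pi.single 1 1) (Pi.single 2 1) (Pi.single 1 1) (Pi.single 3 1)) 0
  all_goals try refine .inr ⟨fun x y z w => ?_, fun x y z w => ?_, fun x y z w => ?_⟩
  all_goals
    ext i
    simp only [jac, LinearMap.add_apply, LinearMap.sub_apply, LinearMap.smul_apply, Pi.add_apply,
      Pi.sub_apply, Pi.smul_apply, Pi.zero_apply, smul_eq_mul, prd_apply, Fin.isValue,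
      Fin.reduceEq, reduceIte, mul_zero, zero_mul, sub_zero, zero_sub, add_zero,
      zero_add, sub_self, ite_self]
  all_goals split_ifs <;> ring

theorem IsListed.isMalcev (h : IsListed ν) : IsMalcev ν :=
  h.isLie_or_isMetabelian.elim (fun h' => h'.1.isMalcev)
    fun h' => h.isAnticomm.isMalcev_of_jac h'.2.1 h'.2.2

theorem IsListed.isTortkara_or_isLie (h : IsListed ν) :
    IsTortkara ν ∨ (IsLie ν ∧ ¬ IsMetabelian ν) :=
  h.isLie_or_isMetabelian.symm.imp_left fun h' => h'.1.isTortkara h.isAnticomm h'.2.1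

end ListedAlgebras

section SixDimensionalAlgebras

variable {V : Type*} [AddCommGroup V] [Module ℂ V] {μ : Alg V}

theorem Iso.eq_zero {W : Type*} [AddCommGroup W] [Module ℂ W] (h : Iso μ (0 : Alg W)) : μ = 0 := by
  obtain ⟨f, hf⟩ := h
  exact LinearMap.ext₂ fun x y => f.injective (by simp [hf])

theorem IsMalcev.isTortkara_or_isLie_of_finrank_eq_six (hM : IsMalcev μ) (hN : IsNilp μ)
    (hV : Module.finrank ℂ V = 6) : IsTortkara μ ∨ (IsLie μ ∧ ¬ IsMetabelian μ) := by
  obtain ⟨ν, hν, e⟩ := isComplete_six V μ hV hN hM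
  obtain ⟨f, hf⟩ := e.exists_isSurjHom
  obtain ⟨g, hg⟩ := e.symm.exists_isSurjHom
  rcases hν with rfl | hν
  · exact .inl (hg.isTortkara ⟨fun _ _ => by simp, fun _ _ _ => by simp⟩)
  · exact hν.isTortkara_or_isLie.imp hg.isTortkara fun h =>
      ⟨hg.isLie h.1, fun h' => h.2 (hf.isMetabelian h')⟩

theorem IsMalcev.exists_isListed_of_finrank_eq_six (hM : IsMalcev μ) (hN : IsNilp μ)
    (hV : Module.finrank ℂ V = 6) (h₀ : μ ≠ 0) : ∃ ν, IsListed ν ∧ Iso μ ν := by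
  obtain ⟨ν, rfl | hν, e⟩ := isComplete_six V μ hV hN hM
  · exact absurd e.eq_zero h₀
  · exact ⟨ν, hν, e⟩

end SixDimensionalAlgebras

end NilpMalcev

theorem mainTheorem3_general :
    (∀ ν : NilpMalcev.Alg (Fin 6 → ℂ), NilpMalcev.IsListed ν →
      NilpMalcev.IsNilp ν ∧ NilpMalcev.IsMalcev ν ∧ ν ≠ 0) ∧
    ∀ (V : Type*) [AddCommGroup V] [Module ℂ V] (μ : NilpMalcev.Alg V),
      Module.finrank ℂ V = 6 → NilpMalcev.IsNilp μ → NilpMalcev.IsMalcev μ →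
        (¬ NilpMalcev.IsLie μ → NilpMalcev.IsTortkara μ) ∧
        (NilpMalcev.IsMetabelian μ → NilpMalcev.IsTortkara μ) ∧
        (μ ≠ 0 → ∃ ν : NilpMalcev.Alg (Fin 6 → ℂ), NilpMalcev.IsListed ν ∧ NilpMalcev.Iso μ ν) := by
  refine ⟨fun ν h => ⟨h.isNilp, h.isMalcev, h.ne_zero⟩, fun V _ _ μ hV hN hM => ?_⟩
  have h := hM.isTortkara_or_isLie_of_finrank_eq_six hN hV
  exact ⟨fun hL => h.resolve_right fun h' => hL h'.1, fun hm => h.resolve_right fun h' => h'.2 hm,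
    hM.exists_isListed_of_finrank_eq_six hN hV⟩

theorem mainTheorem3 :
    (∀ ν : NilpMalcev.Alg (Fin 6 → ℂ), NilpMalcev.IsListed ν →
      NilpMalcev.IsNilp ν ∧ NilpMalcev.IsMalcev ν ∧ ν ≠ 0) ∧
    ∀ (V : Type*) [AddCommGroup V] [Module ℂ V] (μ : NilpMalcev.Alg V),
      Module.finrank ℂ V = 6 → NilpMalcev.IsNilp μ → NilpMalcev.IsMalcev μ →
        (¬ NilpMalcev.IsLie μ → NilpMalcev.IsTortkara μ) ∧
        (NilpMalcev.IsMetabelian μ → NilpMalcev.IsTortkara μ) ∧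
        (NilpMalcev.IsTortkara μ → μ ≠ 0 →
          ∃ ν : NilpMalcev.Alg (Fin 6 → ℂ), NilpMalcev.IsListed ν ∧ NilpMalcev.Iso μ ν) :=
  mainTheorem3_general.imp_right fun h V _ _ μ hV hN hM =>
    (h V μ hV hN hM).imp_right fun h' => h'.imp_right fun h'' _ => h''
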